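/- Let $\mathbb T^2=(\mathbb R/2\pi\mathbb Z)^2$, let $\mathbb S^1\subset\mathbb R^2$ be the unit circle with arc length, whose points are written $v=(\cos\varphi,\sin\varphi)$, and let $\mathcal H=L^2(\mathbb T^2\times\mathbb S^1;\mathbb C)$. Consider the Lorentz kinetic equation with unit relaxation rate in dimension two, $$\partial_t f+v\cdot\nabla_x f=\tilde f-f,\qquad \tilde f(x)=\frac1{2\pi}\int_{\mathbb S^1}f(x,w)\,dw ,$$ that is, $\partial_t f=-Cf$ with $C=R-J$, where $Rf=f-\tilde f$ is bounded on $\mathcal H$ and $J=-v\cdot\nabla_x$ (in the sense of distributions) has domain $\{f\in\mathcal H: v\cdot\nabla_xf\in\mathcal H\}$; $C$ has the same domain as $J$. Let $\mathcal D_\circ$ be the set of all $f\in\mathcal H$ whose second order weak $x$-derivatives all lie in $\mathcal H$, and put $$\mathcal D=\mathcal D_\circ\cap\Big\{f\in\mathcal H:\int_{\mathbb T^2\times\mathbb S^1}f\,dx\,dv=0\Big\}.$$ The operator $-C$ generates a unique $C_0$-semigroup $P(t)=e^{-Ct}$, $t\ge0$, on $\mathcal H$, and the following hold. (a) The set $\mathcal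 D$ lies in the domain of $R+JRJ^*$, and with $\kappa=\frac{3-\sqrt5}2$ $$\langle (R+JRJ^*)f,f\rangle\ge\kappa\|f\|^2\qquad\text{for all } f\in\mathcal D .$$ The hypocoercivity index of $C$ on $\mathcal D$ is $1$: the smallest integer $m\ge0$ for which there is some $\kappa'>0$ such that $\sum_{j=0}^mJ^jR(J^*)^j\ge\kappa' I$ on $\mathcal D$ is $m=1$. Moreover $C$ is hypocoercive on the mean-zero functions (in particular on $\mathcal D$): there are constants $K$ and $\lambda>0$ with $\|P(t)f\|\le Ke^{-\lambda t}\|f\|$ for all $t\ge0$ and all $f\in\mathcal H$ with $\int f\,dx\,dv=0$. (b) For $f_0\in\mathcal H$ let $f_\infty$ be the constant function $\frac1{(2\pi)^3}\int_{\mathbb T^2\times\mathbb S^1}f_0\,dx\,dv$. Then $f_\infty$ is the unique equilibrium with the mass of $f_0$, i.e. the unique $g$ in the domain of $C$ with $Cg=0$ and $\int g\,dx\,dv=\int f_0\,dx\,dv$, and the solution $f(t)=P(t)f_0$ satisfies $$\|f(t)-f_\infty\|\le\sqrt3\,e^{-\lambda_0t}\,\|f_0-f_\infty\|\qquad\text{for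 all }t\ge0,\qquad \lambda_0=\frac12-\frac1{6\sqrt2}-\frac13\sqrt{\frac7{16}+\frac1{\sqrt8}} .$$ (c) Let $\Pi_\infty$ be the orthogonal projection of $\mathcal H$ onto the constant functions. There are constants $c,\tilde c,\tau>0$ such that, in the operator norm of $\mathcal H$, $$1-\tilde c\,t^3\le\|P(t)-\Pi_\infty\|\le1-c\,t^3\qquad\text{for all }0\le t\le\tau .$$ -/

import Mathlib

open MeasureTheory Filter Topology
open scoped ContDiff NNReal

noncomputable section

namespace Lorentz

instance fact_two_pi_pos : Fact (0 < 2 * Real.pi) := ⟨Real.two_pi_pos⟩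

/-- The circle `ℝ / 2πℤ`, with Lebesgue measure of total mass `2π`. -/
abbrev T : Type := AddCircle (2 * Real.pi)

/-- The phase space `𝕋² × 𝕊¹`; the velocity `v = (cos φ, sin φ)` is given by its angle `φ`, so that
the volume is `dx dφ`, of total mass `(2π)³`. -/
abbrev Phase : Type := (Fin 2 → T) × T

/-- The Hilbert space `L²(𝕋² × 𝕊¹; ℂ)`. -/
abbrev H : Type := Lp ℂ 2 (volume : Measure Phase)

/-- The `i`-th component of the velocity with angle `φ`, that is `cos φ` resp. `sin φ`. -/
def vel : Fin 2 → T → ℝ := ![Real.cos_periodic.lift, Real.sin_periodic.lift]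

/-! ### Smooth test functions and differentiation in the position variable -/

/-- The covering map `ℝ² × ℝ → 𝕋² × 𝕊¹`. -/
def cover (p : (Fin 2 → ℝ) × ℝ) : Phase := (fun i => (p.1 i : T), (p.2 : T))

/-- Smooth functions on `𝕋² × 𝕊¹`: their periodic lift is smooth. -/
def IsTest (ψ : Phase → ℂ) : Prop := ContDiff ℝ ∞ (ψ ∘ cover)

/-- The classical partial derivative `∂ψ/∂xᵢ`. -/
def dx (i : Fin 2) (ψ : Phase → ℂ) (z : Phase) : ℂ :=
  deriv (fun s : ℝ => ψ (z.1 + Pi.single i (s : T), z.2)) 0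

/-- The classical expression `v · ∇ₓ ψ`. -/
def vgrad (ψ : Phase → ℂ) (z : Phase) : ℂ := ∑ i, (vel i z.2 : ℂ) * dx i ψ z

/-- `g = v · ∇ₓ f` in the sense of distributions on `𝕋² × 𝕊¹`. -/
def IsWeakVGrad (f g : H) : Prop :=
  ∀ ψ : Phase → ℂ, IsTest ψ → ∫ z, f z * vgrad ψ z = -∫ z, g z * ψ z

/-- `g = ∂²f/∂xᵢ∂xⱼ` in the sense of distributions on `𝕋² × 𝕊¹`. -/
def IsWeakSecond (i j : Fin 2) (f g : H) : Prop :=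
  ∀ ψ : Phase → ℂ, IsTest ψ → ∫ z, f z * dx i (dx j ψ) z = ∫ z, g z * ψ z

/-! #### Helper facts -/

lemma isOpenQuotientMap_cover : IsOpenQuotientMap cover := by
  have h : IsOpenQuotientMap (fun x : ℝ => (x : T)) := QuotientAddGroup.isOpenQuotientMap_mk
  exact (IsOpenQuotientMap.piMap (fun _ : Fin 2 => h)).prodMap h

lemma cover_surjective : Function.Surjective cover := isOpenQuotientMap_cover.surjective

lemma continuous_cover : Continuous cover := isOpenQuotientMap_cover.continuous

lemma IsTest.continuous {ψ : Phase → ℂ} (h : IsTest ψ) : Continuous ψ :=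
  isOpenQuotientMap_cover.continuous_comp_iff.1 (ContDiff.continuous h)

lemma cover_add_single (p : (Fin 2 → ℝ) × ℝ) (i : Fin 2) (s : ℝ) :
    ((cover p).1 + Pi.single i (s : T), (cover p).2)
      = cover (p + s • ((Pi.single i 1, 0) : (Fin 2 → ℝ) × ℝ)) := by
  refine Prod.ext ?_ ?_
  · funext k
    by_cases hk : k = i
    · subst hk; simp [cover]
    · simp [cover, hk]
  · simp [cover]

lemma dx_cover {ψ : Phase → ℂ} (h : IsTest ψ) (i : Fin 2) (p : (Fin 2 → ℝ) × ℝ) :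
    dx i ψ (cover p) = fderiv ℝ (ψ ∘ cover) p (Pi.single i 1, 0) := by
  have hd : DifferentiableAt ℝ (ψ ∘ cover) p := (ContDiff.differentiable h (by simp)) p
  unfold dx
  simp only [cover_add_single]
  exact hd.lineDeriv_eq_fderiv (v := ((Pi.single i 1, 0) : (Fin 2 → ℝ) × ℝ))

lemma IsTest.dx {ψ : Phase → ℂ} (h : IsTest ψ) (i : Fin 2) : IsTest (dx i ψ) := by
  have : Lorentz.dx i ψ ∘ cover = fun p => fderiv ℝ (ψ ∘ cover) p (Pi.single i 1, 0) :=
    funext fun p => dx_cover h i p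
  unfold IsTest
  rw [this]
  have h1 : ContDiff ℝ ∞ (fderiv ℝ (ψ ∘ cover)) := ContDiff.fderiv_right h (by simp)
  exact h1.clm_apply contDiff_const

lemma vel_coe_zero (s : ℝ) : vel 0 (s : T) = Real.cos s := rfl

lemma vel_coe_one (s : ℝ) : vel 1 (s : T) = Real.sin s := rfl

lemma isTest_vel (i : Fin 2) : IsTest (fun z => (vel i z.2 : ℂ)) := by
  unfold IsTest
  refine Complex.ofRealCLM.contDiff.comp ?_
  fin_cases i
  · exact Real.contDiff_cos.comp contDiff_snd
  · exact Real.contDiff_sin.comp contDiff_snd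

lemma IsTest.vgrad {ψ : Phase → ℂ} (h : IsTest ψ) : IsTest (vgrad ψ) := by
  have : Lorentz.vgrad ψ ∘ cover
      = fun p => ∑ i, ((fun z : Phase => (vel i z.2 : ℂ)) ∘ cover) p
          * (Lorentz.dx i ψ ∘ cover) p := rfl
  unfold IsTest
  rw [this]
  exact ContDiff.sum fun i _ => (isTest_vel i).mul (h.dx i)

lemma integrable_mul (f : H) {ψ : Phase → ℂ} (h : Continuous ψ) :
    Integrable (fun z => f z * ψ z) := by
  obtain ⟨C, hC⟩ := isCompact_univ.exists_bound_of_continuousOn h.continuousOn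
  exact ((Lp.memLp f).integrable (by norm_num)).mul_bdd (c := C)
    h.aestronglyMeasurable (ae_of_all _ fun z => hC z trivial)

/-- The test functions as a star subalgebra of the continuous functions. -/
def testAlgebra : StarSubalgebra ℂ C(Phase, ℂ) where
  carrier := {ψ | IsTest ψ}
  mul_mem' {a b} (ha : ContDiff ℝ ∞ (a ∘ cover)) (hb : ContDiff ℝ ∞ (b ∘ cover)) := ha.mul hb
  one_mem' := (contDiff_const : ContDiff ℝ ∞ fun _ : (Fin 2 → ℝ) × ℝ => (1 : ℂ))
  add_mem' {a b} (ha : ContDiff ℝ ∞ (a ∘ cover)) (hb : ContDiff ℝ ∞ (b ∘ cover)) := ha.add hb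
  zero_mem' := (contDiff_const : ContDiff ℝ ∞ fun _ : (Fin 2 → ℝ) × ℝ => (0 : ℂ))
  algebraMap_mem' c := (contDiff_const : ContDiff ℝ ∞ fun _ : (Fin 2 → ℝ) × ℝ => c)
  star_mem' {a} (ha : ContDiff ℝ ∞ (a ∘ cover)) := Complex.conjCLE.contDiff.comp ha

lemma testAlgebra_separatesPoints : testAlgebra.toSubalgebra.SeparatesPoints := by
  have hf : ContDiff ℝ ∞ (fun s : ℝ => fourier 1 (s : T)) := by
    have : (fun s : ℝ => fourier 1 (s : T))
        = fun s : ℝ => Complex.exp ((s : ℂ) * Complex.I) := by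
      funext s
      rw [fourier_coe_apply]
      congr 1
      have : (Real.pi : ℂ) ≠ 0 := by exact_mod_cast Real.pi_ne_zero
      push_cast
      field_simp
    rw [this]
    exact (Complex.ofRealCLM.contDiff.mul contDiff_const).cexp
  have hinj : ∀ a b : T, fourier 1 a = fourier 1 b → a = b := fun a b h => by
    rw [fourier_one, fourier_one] at h
    exact AddCircle.injective_toCircle (Real.two_pi_pos.ne') (Subtype.ext h)
  intro a b hab
  by_cases h2 : a.2 = b.2
  · have h1 : a.1 ≠ b.1 := fun h1 => hab (Prod.ext h1 h2)
    obtain ⟨i, hi⟩ := Function.ne_iff.1 h1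
    let F : C(Phase, ℂ) := ⟨fun z => fourier 1 (z.1 i), by fun_prop⟩
    refine ⟨F, ⟨F, ?_, rfl⟩, fun h => hi (hinj _ _ h)⟩
    exact hf.comp (f := fun p : (Fin 2 → ℝ) × ℝ => p.1 i) (by fun_prop)
  · let F : C(Phase, ℂ) := ⟨fun z => fourier 1 z.2, by fun_prop⟩
    refine ⟨F, ⟨F, ?_, rfl⟩, fun h => h2 (hinj _ _ h)⟩
    exact hf.comp (f := fun p : (Fin 2 → ℝ) × ℝ => p.2) (by fun_prop)

/-- An `L²` function that integrates to zero against every test function vanishes. -/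
lemma eq_zero_of_test (g : H) (hg : ∀ ψ : Phase → ℂ, IsTest ψ → ∫ z, g z * ψ z = 0) : g = 0 := by
  have hdense := ContinuousMap.starSubalgebra_topologicalClosure_eq_top_of_separatesPoints
    testAlgebra testAlgebra_separatesPoints
  let L : C(Phase, ℂ) →L[ℂ] H := ContinuousMap.toLp 2 volume ℂ
  have hzero : ∀ ψ : C(Phase, ℂ), inner ℂ (L ψ) g = 0 := by
    have hcl : IsClosed {ψ : C(Phase, ℂ) | inner ℂ (L ψ) g = 0} :=
      isClosed_eq (by fun_prop) continuous_const
    have hsub : (testAlgebra : Set C(Phase, ℂ)) ⊆ {ψ | inner ℂ (L ψ) g = 0} := by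
      intro ψ hψ
      have h1 := hg _ (star_mem hψ : star ψ ∈ testAlgebra)
      change inner ℂ (L ψ) g = 0
      rw [L2.inner_def, ← h1]
      refine integral_congr_ae ?_
      filter_upwards [ContinuousMap.coeFn_toLp (p := 2) (𝕜 := ℂ) volume ψ] with z hz
      change inner ℂ ((L ψ) z) (g z) = g z * (star ψ) z
      rw [show (L ψ) z = ψ z from hz]
      simp
    have h2 := closure_minimal hsub hcl
    intro ψ
    refine h2 ?_
    rw [← StarSubalgebra.topologicalClosure_coe, hdense]
    trivial
  have hd : DenseRange L := ContinuousMap.toLp_denseRange ℂ volume ℂ (by norm_num)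
  have h3 : ∀ f : H, inner ℂ f g = 0 := by
    intro f
    refine hd.induction_on (p := fun f : H => inner ℂ f g = 0) f
      (isClosed_eq (by fun_prop) continuous_const) hzero
  exact inner_self_eq_zero.1 (h3 g)

/-! ### The operators -/

/-- The graph of `f ↦ v · ∇ₓ f` on `{f ∈ H | v · ∇ₓ f ∈ H}`. -/
def streamGraph : Submodule ℂ (H × H) where
  carrier := {p | IsWeakVGrad p.1 p.2}
  zero_mem' := by
    intro ψ _
    rw [integral_eq_zero_of_ae, integral_eq_zero_of_ae, neg_zero]
    · exact ae_of_all _ fun z => by simp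
    · exact ae_of_all _ fun z => by simp
  add_mem' := by
    intro a b ha hb ψ hψ
    have e1 : ∫ z, (a + b).1 z * vgrad ψ z
        = ∫ z, (a.1 z * vgrad ψ z + b.1 z * vgrad ψ z) := by
      refine integral_congr_ae ?_
      filter_upwards [Lp.coeFn_add a.1 b.1] with z hz
      change (a.1 + b.1 : H) z * _ = _
      rw [hz, Pi.add_apply, add_mul]
    have e2 : ∫ z, (a + b).2 z * ψ z = ∫ z, (a.2 z * ψ z + b.2 z * ψ z) := by
      refine integral_congr_ae ?_
      filter_upwards [Lp.coeFn_add a.2 b.2] with z hz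
      change (a.2 + b.2 : H) z * _ = _
      rw [hz, Pi.add_apply, add_mul]
    rw [e1, e2, integral_add (integrable_mul _ hψ.vgrad.continuous)
      (integrable_mul _ hψ.vgrad.continuous), integral_add (integrable_mul _ hψ.continuous)
      (integrable_mul _ hψ.continuous), ha ψ hψ, hb ψ hψ]
    ring
  smul_mem' := by
    intro c a ha ψ hψ
    have e1 : ∫ z, (c • a).1 z * vgrad ψ z = ∫ z, c * (a.1 z * vgrad ψ z) := by
      refine integral_congr_ae ?_
      filter_upwards [Lp.coeFn_smul c a.1] with z hz
      simp [hz, mul_assoc]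
    have e2 : ∫ z, (c • a).2 z * ψ z = ∫ z, c * (a.2 z * ψ z) := by
      refine integral_congr_ae ?_
      filter_upwards [Lp.coeFn_smul c a.2] with z hz
      simp [hz, mul_assoc]
    rw [e1, e2, integral_const_mul, integral_const_mul, ha ψ hψ]
    ring

/-- The unbounded operator `f ↦ v · ∇ₓ f` in `H` with domain `{f ∈ H | v · ∇ₓ f ∈ H}`. -/
def stream : H →ₗ.[ℂ] H := streamGraph.toLinearPMap

lemma mem_stream_graph (f g : H) : (f, g) ∈ stream.graph ↔ IsWeakVGrad f g := by
  unfold stream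
  rw [Submodule.toLinearPMap_graph_eq]
  · rfl
  · rintro ⟨f, g⟩ hfg (rfl : f = 0)
    refine eq_zero_of_test g fun ψ hψ => ?_
    have h := hfg ψ hψ
    have h0 : ∫ z, (0 : H) z * vgrad ψ z = 0 := by
      exact integral_eq_zero_of_ae (ae_of_all _ fun z => by simp)
    exact neg_eq_zero.1 (h.symm.trans h0)

/-- The skew-adjoint operator `J = - v · ∇ₓ`. -/
def J : H →ₗ.[ℂ] H := -stream

/-- The mean over the velocity circle, as a function on phase space. -/
def velMeanFun (f : Phase → ℂ) (z : Phase) : ℂ := ⨍ w : T, f (z.1, w)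

lemma stronglyMeasurable_velMeanFun {f : Phase → ℂ} (hf : StronglyMeasurable f) :
    StronglyMeasurable (velMeanFun f) := by
  have : StronglyMeasurable (fun x : Fin 2 → T => ⨍ w : T, f (x, w)) :=
    hf.integral_prod_right'
  exact this.comp_measurable measurable_fst

lemma eLpNorm_velMeanFun_le (f : Phase → ℂ) (hf : StronglyMeasurable f) :
    eLpNorm (velMeanFun f) 2 volume ≤ eLpNorm f 2 volume := by
  set V : ENNReal := volume (Set.univ : Set T) with hV
  have hV0 : V ≠ 0 := by simp [hV, Real.pi_pos]
  have hVt : V ≠ ⊤ := measure_ne_top _ _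
  set μ : Measure T := V⁻¹ • volume with hμ
  have hprob : IsProbabilityMeasure μ :=
    ⟨by rw [hμ, Measure.smul_apply, smul_eq_mul, ← hV, ENNReal.inv_mul_cancel hV0 hVt]⟩
  have key : ∀ x : Fin 2 → T, ‖⨍ w : T, f (x, w)‖ₑ ^ (2 : ℝ)
      ≤ V⁻¹ * ∫⁻ w : T, ‖f (x, w)‖ₑ ^ (2 : ℝ) := by
    intro x
    have hm : AEStronglyMeasurable (fun w : T => f (x, w)) μ :=
      (hf.comp_measurable measurable_prodMk_left).aestronglyMeasurable
    have h1 : ‖⨍ w : T, f (x, w)‖ₑ ≤ eLpNorm (fun w : T => f (x, w)) 1 μ := by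
      rw [eLpNorm_one_eq_lintegral_enorm]
      exact enorm_integral_le_lintegral_enorm _
    have h2 : eLpNorm (fun w : T => f (x, w)) 1 μ ≤ eLpNorm (fun w : T => f (x, w)) 2 μ :=
      eLpNorm_le_eLpNorm_of_exponent_le (by norm_num) hm
    have h3 := ENNReal.rpow_le_rpow (h1.trans h2) (by norm_num : (0 : ℝ) ≤ 2)
    refine h3.trans (le_of_eq ?_)
    rw [eLpNorm_eq_lintegral_rpow_enorm_toReal (by norm_num) (by norm_num), ← ENNReal.rpow_mul]
    simp [hμ]
  rw [eLpNorm_eq_lintegral_rpow_enorm_toReal (by norm_num) (by norm_num),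
    eLpNorm_eq_lintegral_rpow_enorm_toReal (by norm_num) (by norm_num)]
  refine ENNReal.rpow_le_rpow ?_ (by norm_num)
  simp only [ENNReal.toReal_ofNat]
  have hvol : (volume : Measure Phase) = (volume : Measure (Fin 2 → T)).prod volume := rfl
  have hmf : Measurable fun z : Phase => ‖f z‖ₑ ^ (2 : ℝ) := hf.measurable.enorm.pow_const _
  have hmg : Measurable fun z : Phase => ‖velMeanFun f z‖ₑ ^ (2 : ℝ) :=
    (stronglyMeasurable_velMeanFun hf).measurable.enorm.pow_const _
  rw [hvol, lintegral_prod _ hmg.aemeasurable, lintegral_prod _ hmf.aemeasurable]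
  refine lintegral_mono fun x => ?_
  simp only [velMeanFun, lintegral_const]
  refine (mul_le_mul_left (key x) _).trans (le_of_eq ?_)
  rw [mul_comm, ← mul_assoc, ← hV, ENNReal.mul_inv_cancel hV0 hVt, one_mul]

lemma memLp_velMeanFun (f : H) : MemLp (velMeanFun f) 2 volume :=
  ⟨(stronglyMeasurable_velMeanFun (Lp.stronglyMeasurable f)).aestronglyMeasurable,
    (eLpNorm_velMeanFun_le f (Lp.stronglyMeasurable f)).trans_lt (Lp.eLpNorm_lt_top f)⟩

lemma velMeanFun_congr {f g : Phase → ℂ} (h : f =ᵐ[volume] g) :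
    velMeanFun f =ᵐ[volume] velMeanFun g := by
  have h1 : ∀ᵐ x : Fin 2 → T, ∀ᵐ w : T, f (x, w) = g (x, w) := Measure.ae_ae_of_ae_prod h
  have h2 : ∀ᵐ z : Phase, ∀ᵐ w : T, f (z.1, w) = g (z.1, w) :=
    Measure.quasiMeasurePreserving_fst.ae h1
  filter_upwards [h2] with z hz
  exact average_congr hz

lemma ae_integrable_slice (f : H) : ∀ᵐ z : Phase, Integrable (fun w : T => f (z.1, w)) := by
  have h : Integrable f ((volume : Measure (Fin 2 → T)).prod volume) :=
    (Lp.memLp f).integrable (by norm_num)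
  exact Measure.quasiMeasurePreserving_fst.ae h.prod_right_ae

/-- The bounded operator `f ↦ f̃`, `f̃(x, v) = (1 / meas 𝕊¹) ∫ f(x, w) dw`. -/
def velMean : H →L[ℂ] H :=
  LinearMap.mkContinuous
    { toFun := fun f => (memLp_velMeanFun f).toLp _
      map_add' := by
        intro f g
        rw [← MemLp.toLp_add]
        refine MemLp.toLp_congr _ _ ?_
        refine (velMeanFun_congr (Lp.coeFn_add f g)).trans ?_
        filter_upwards [ae_integrable_slice f, ae_integrable_slice g] with z hf hg
        simp only [velMeanFun, Pi.add_apply, average_eq]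
        rw [integral_add hf hg, smul_add]
      map_smul' := by
        intro c f
        rw [RingHom.id_apply, ← MemLp.toLp_const_smul]
        refine MemLp.toLp_congr _ _ ?_
        refine (velMeanFun_congr (Lp.coeFn_smul c f)).trans (ae_of_all _ fun z => ?_)
        simp only [velMeanFun, Pi.smul_apply, average_eq]
        rw [integral_smul, smul_comm] }
    1 (by
      intro f
      rw [one_mul]
      change ‖(memLp_velMeanFun f).toLp _‖ ≤ ‖f‖
      rw [Lp.norm_toLp, Lp.norm_def]
      exact ENNReal.toReal_mono (Lp.eLpNorm_ne_top f)
        (eLpNorm_velMeanFun_le f (Lp.stronglyMeasurable f)))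

lemma coeFn_velMean (f : H) : velMean f =ᵐ[volume] velMeanFun f :=
  MemLp.coeFn_toLp (memLp_velMeanFun f)

/-- The collision part `R f = f - f̃`. -/
def R : H →L[ℂ] H := ContinuousLinearMap.id ℂ H - velMean

/-- The operator `C = R - J`, with domain the domain of `J`. -/
def C : H →ₗ.[ℂ] H := (R : H →ₗ[ℂ] H).toPMap ⊤ - J

/-! ### The hypocoercivity index -/

/-- `PowGraph A n f g`: `f` lies in the domain of `Aⁿ` and `Aⁿ f = g`. -/
def PowGraph (A : H →ₗ.[ℂ] H) : ℕ → H → H → Prop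
  | 0, f, g => g = f
  | n + 1, f, g => ∃ h : f ∈ A.domain, PowGraph A n (A ⟨f, h⟩) g

/-- The inequality `∑_{j ≤ m} Kʲ S (K*)ʲ ≥ κ I` on the set `D`, including that `D` lies in the
domain of the left-hand side. -/
def CoerciveSum (S : H →L[ℂ] H) (K : H →ₗ.[ℂ] H) (D : Set H) (m : ℕ) (κ : ℝ) : Prop :=
  ∀ f ∈ D, ∃ g : ℕ → H,
    (∀ j ≤ m, ∃ u, PowGraph K.adjoint j f u ∧ PowGraph K j (S u) (g j)) ∧
    κ * ‖f‖ ^ 2 ≤ (inner ℂ f (∑ j ∈ Finset.range (m + 1), g j)).re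

/-- `m` is the hypocoercivity index of `S - K` on `D`: the smallest `m` such that
`∑_{j ≤ m} Kʲ S (K*)ʲ ≥ κ I` on `D` for some `κ > 0`. -/
def IsHCIndex (S : H →L[ℂ] H) (K : H →ₗ.[ℂ] H) (D : Set H) (m : ℕ) : Prop :=
  IsLeast {k : ℕ | ∃ κ : ℝ, 0 < κ ∧ CoerciveSum S K D k κ} m

/-- The functions of total mass zero. -/
def meanZero : Set H := {f | ∫ z, f z = 0}

/-- The functions all of whose second order weak `x`-derivatives lie in `H`. -/
def secondOrder : Set H := {f | ∀ i j, ∃ g : H, IsWeakSecond i j f g}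

/-! ### Semigroups -/

/-- `P` is a `C₀`-semigroup on `H`. -/
structure IsC0Semigroup (P : ℝ≥0 → H →L[ℂ] H) : Prop where
  zero : P 0 = ContinuousLinearMap.id ℂ H
  add : ∀ s t, P (s + t) = (P s).comp (P t)
  continuous : ∀ f, Continuous fun t => P t f

/-- `P` is a `C₀`-semigroup with generator exactly `A` (domain included). -/
def IsGeneratedBy (P : ℝ≥0 → H →L[ℂ] H) (A : H →ₗ.[ℂ] H) : Prop :=
  IsC0Semigroup P ∧ ∀ f g : H, (f, g) ∈ A.graph ↔
    Tendsto (fun t : ℝ≥0 => (t : ℝ)⁻¹ • (P t f - f)) (𝓝[>] 0) (𝓝 g)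

/-- Exponential decay of the semigroup `P` on the subset `D`. -/
def HypocoerciveOn (P : ℝ≥0 → H →L[ℂ] H) (D : Set H) : Prop :=
  ∃ K lam : ℝ, 0 < lam ∧ ∀ f ∈ D, ∀ t : ℝ≥0, ‖P t f‖ ≤ K * Real.exp (-lam * t) * ‖f‖

/-- The constant function with value `a`, as an element of `H`. -/
def constFun (a : ℂ) : H := Lp.const 2 volume a

/-- The equilibrium `f_∞ = (2π)⁻³ ∫ f dv dx`. -/
def equil (f : H) : H := constFun ((1 / (2 * Real.pi) ^ 3 : ℝ) * ∫ z, f z)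

/-- The orthogonal projection of `H` onto the constant functions. -/
def projConst : H →L[ℂ] H := (Submodule.span ℂ {constFun 1}).starProjection

/-- The decay rate `λ₀`. -/
def rate : ℝ :=
  1 / 2 - 1 / (6 * Real.sqrt 2) - 1 / 3 * Real.sqrt (7 / 16 + 1 / Real.sqrt 8)

end Lorentz

end

noncomputable section

namespace Lorentz

open ComplexConjugate

/-! ### Square-summable families -/

section SquareSummable

variable {ι : Type*} {G : ι → Type*} [∀ i, NormedAddCommGroup (G i)]

/-! Expansion in the characters `e^{i n·x} e^{i k φ}` (`modes`) decouples the equation over the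
spatial frequencies `n`. Since `n·v = z e^{iφ} + z̄ e^{-iφ}` with `z = freq n`, the generator on one
frequency is a bounded operator `modeGen z` on `ℓ²(ℤ)`: collisions damp every coefficient with `k ≠
0`, and transport (`trans z`) links `k` to `k ± 1`. Everything then follows from estimates on one
mode that are uniform in `n`. For `n ≠ 0` the only information needed on `z` is `|z|² ≥ 1/4`
(`norm_freq_sq_ge`); for `n = 0` transport vanishes and the flow is explicit.

Coercivity (`mode_coercive`): collisions miss only `h 0`, and transport carries `h 0` to `k = ±1`,
where collisions see it. Summing an optimally weighted inequality for `|z h(k-1) + z̄ h(k+1)|²`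
gives the constant `κ`. Functions of `x` alone, on which `R` vanishes, show that the index is not
`0`.

Long-time decay (`mode_lyapunov`): the energy alone dissipates only `‖coll h‖²`. The quantity
`coupling` is a multiple of the time derivative of `|h 0|²`, and its own derivative contains `+|h
0|²`. Subtracting a multiple of it from the energy gives a Lyapunov functional that lies between
`1/2` and `3/2` of the energy, whence the factor `√3`. The rate obtained is `1/10`, which exceeds
`λ₀`.

Short-time decay: the cubic upper bound (`norm_flow_le_short`) uses the same coupling with a
time-dependent weight that vanishes at both ends of `[0, t]`. The cubic lower bound
(`norm_flow_single_ge`) comes from data independent of `v`: they leave the kernel of the collisions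
at linear speed, so the dissipation is quadratic and the energy loss cubic.

The flows of the modes are contractions, so they assemble into `propagator`. Dominated convergence
over the modes identifies its generator exactly, and uniqueness for linear ODEs on each mode gives
uniqueness of the semigroup. -/

lemma hasSum_norm_sq (f : lp G 2) : HasSum (fun i => ‖f i‖ ^ 2) (‖f‖ ^ 2) := by
  have h := lp.hasSum_norm (p := 2) (by norm_num) f
  simpa using h

lemma memℓp_two_iff {f : ∀ i, G i} : Memℓp f 2 ↔ Summable fun i => ‖f i‖ ^ 2 := by
  rw [memℓp_gen_iff (by norm_num)]
  simp

lemma norm_le_of_apply_le {G' : ι → Type*} [∀ i, NormedAddCommGroup (G' i)]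
    {f : lp G 2} {g : lp G' 2} {c : ℝ} (hc : 0 ≤ c)
    (h : ∀ i, ‖f i‖ ≤ c * ‖g i‖) : ‖f‖ ≤ c * ‖g‖ := by
  have h2 : ‖f‖ ^ 2 ≤ (c * ‖g‖) ^ 2 := by
    rw [mul_pow]
    refine hasSum_le (fun i => ?_) (hasSum_norm_sq f) ((hasSum_norm_sq g).mul_left (c ^ 2))
    rw [← mul_pow]
    exact pow_le_pow_left₀ (norm_nonneg _) (h i) 2
  exact (pow_le_pow_iff_left₀ (norm_nonneg _) (by positivity) two_ne_zero).1 h2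

/-- Dominated convergence for square-summable families. -/
lemma tendsto_of_dominated {α : Type*} {l : Filter α} {F : α → lp G 2} {f : lp G 2} {b : ι → ℝ}
    (hb : Summable b) (hle : ∀ᶠ a in l, ∀ i, ‖F a i - f i‖ ^ 2 ≤ b i)
    (hF : ∀ i, Tendsto (fun a => F a i) l (𝓝 (f i))) : Tendsto F l (𝓝 f) := by
  have h1 : Tendsto (fun a => ∑' i, ‖F a i - f i‖ ^ 2) l (𝓝 (∑' _ : ι, (0 : ℝ))) := by
    refine tendsto_tsum_of_dominated_convergence hb (fun i => ?_) ?_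
    · have h := (((hF i).sub_const (f i)).norm).pow 2
      simpa using h
    · filter_upwards [hle] with a ha i
      rw [Real.norm_of_nonneg (by positivity)]
      exact ha i
  rw [tendsto_iff_norm_sub_tendsto_zero]
  have h2 : (fun a => ‖F a - f‖) = fun a => √(∑' i, ‖F a i - f i‖ ^ 2) := by
    funext a
    rw [show (∑' i, ‖F a i - f i‖ ^ 2) = ‖F a - f‖ ^ 2 from (hasSum_norm_sq (F a - f)).tsum_eq,
      Real.sqrt_sq (norm_nonneg _)]
  rw [h2]
  simpa using h1.sqrt

/-- Evaluation of a square-summable family at an index. -/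
def lpEval (𝕜 : Type*) [NormedRing 𝕜] [∀ i, Module 𝕜 (G i)] [∀ i, IsBoundedSMul 𝕜 (G i)] (i : ι) :
    lp G 2 →L[𝕜] G i :=
  LinearMap.mkContinuous
    { toFun := fun f => f i
      map_add' := fun _ _ => rfl
      map_smul' := fun _ _ => rfl } 1 fun f => by
        rw [one_mul]; exact lp.norm_apply_le_norm (by norm_num) f i

end SquareSummable

/-! ### Square-summable double families as families of slices -/

section Curry

variable {α β : Type*}

lemma summable_curry (f : lp (fun _ : α × β => ℂ) 2) :
    (∀ a, Summable fun b => ‖f (a, b)‖ ^ 2) ∧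
      HasSum (fun a => ∑' b, ‖f (a, b)‖ ^ 2) (‖f‖ ^ 2) := by
  have h := hasSum_norm_sq f
  have h1 : ∀ a, Summable fun b => ‖f (a, b)‖ ^ 2 := fun a => h.summable.prod_factor a
  exact ⟨h1, h.prod_fiberwise fun a => (h1 a).hasSum⟩

/-- The slices of a square-summable double family. -/
def curryFun (f : lp (fun _ : α × β => ℂ) 2) (a : α) : lp (fun _ : β => ℂ) 2 :=
  ⟨fun b => f (a, b), memℓp_two_iff.2 ((summable_curry f).1 a)⟩

lemma norm_curryFun_sq (f : lp (fun _ : α × β => ℂ) 2) (a : α) :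
    ‖curryFun f a‖ ^ 2 = ∑' b, ‖f (a, b)‖ ^ 2 :=
  (hasSum_norm_sq (curryFun f a)).tsum_eq.symm

lemma hasSum_norm_curryFun_sq (f : lp (fun _ : α × β => ℂ) 2) :
    HasSum (fun a => ‖curryFun f a‖ ^ 2) (‖f‖ ^ 2) := by
  simp_rw [norm_curryFun_sq]
  exact (summable_curry f).2

/-- `ℓ²(α × β)` is isometric to `ℓ²(α; ℓ²(β))`. -/
def lpCurry : lp (fun _ : α × β => ℂ) 2 ≃ₗᵢ[ℂ] lp (fun _ : α => lp (fun _ : β => ℂ) 2) 2 where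
  toFun f := ⟨curryFun f, memℓp_two_iff.2 (hasSum_norm_curryFun_sq f).summable⟩
  map_add' _ _ := rfl
  map_smul' _ _ := rfl
  invFun g := ⟨fun p => g p.1 p.2, memℓp_two_iff.2 <| by
    rw [summable_prod_of_nonneg fun _ => by positivity]
    refine ⟨fun a => (hasSum_norm_sq (g a)).summable, ?_⟩
    simp_rw [fun a => (hasSum_norm_sq (g a)).tsum_eq]
    exact (hasSum_norm_sq g).summable⟩
  left_inv _ := rfl
  right_inv _ := rfl
  norm_map' f := by
    have h1 := hasSum_norm_sq
      (⟨curryFun f, memℓp_two_iff.2 (hasSum_norm_curryFun_sq f).summable⟩ :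
        lp (fun _ : α => lp (fun _ : β => ℂ) 2) 2)
    have h2 := h1.unique (hasSum_norm_curryFun_sq f)
    exact (pow_left_inj₀ (norm_nonneg _) (norm_nonneg _) two_ne_zero).1 h2

end Curry

/-! ### Diagonal operators -/

section Diagonal

variable {ι K : Type*} [NormedAddCommGroup K] [NormedSpace ℂ K]

/-- The diagonal operator on `ℓ²(ι; K)` with contractive entries. -/
def diag (T : ι → K →L[ℂ] K) (hT : ∀ i, ‖T i‖ ≤ 1) :
    lp (fun _ : ι => K) 2 →L[ℂ] lp (fun _ : ι => K) 2 :=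
  have hle : ∀ (f : lp (fun _ : ι => K) 2) i, ‖T i (f i)‖ ≤ 1 * ‖f i‖ := fun f i =>
    (T i).le_of_opNorm_le (hT i) (f i)
  LinearMap.mkContinuous
    { toFun := fun f => ⟨fun i => T i (f i), memℓp_two_iff.2 <|
        (hasSum_norm_sq f).summable.of_nonneg_of_le (fun _ => by positivity) fun i =>
          pow_le_pow_left₀ (norm_nonneg _) ((hle f i).trans_eq (one_mul _)) 2⟩
      map_add' := fun f g => lp.ext <| funext fun i => (T i).map_add (f i) (g i)
      map_smul' := fun c f => lp.ext <| funext fun i => (T i).map_smul c (f i) }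
    1 fun f => norm_le_of_apply_le zero_le_one (hle f)

end Diagonal

lemma hasDerivAt_norm_sq {K : Type*} [NormedAddCommGroup K] [InnerProductSpace ℂ K]
    {f : ℝ → K} {f' : K} {t : ℝ}
    (h : HasDerivAt f f' t) :
    HasDerivAt (fun s => ‖f s‖ ^ 2) (2 * (inner ℂ (f t) f').re) t := by
  have h1 := h.inner ℂ h
  have h2 := Complex.reCLM.hasFDerivAt.comp_hasDerivAt t h1
  convert! h2 using 1
  · funext s
    exact (norm_sq_eq_re_inner (𝕜 := ℂ) (f s))
  · rw [← inner_conj_symm f' (f t)]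
    rw [Complex.reCLM_apply, Complex.add_re, Complex.conj_re]
    ring

/-! ### Contraction flows of bounded dissipative operators -/

section DissipativeFlow

variable {K : Type*} [NormedAddCommGroup K] [InnerProductSpace ℂ K] [CompleteSpace K]

/-- The solution operator `exp (t M)` of `u' = M u`. -/
def flow (M : K →L[ℂ] K) (t : ℝ) : K →L[ℂ] K := NormedSpace.exp (t • M)

lemma flow_zero (M : K →L[ℂ] K) : flow M 0 = ContinuousLinearMap.id ℂ K := by
  simp only [flow, zero_smul, NormedSpace.exp_zero]; rfl

lemma flow_add (M : K →L[ℂ] K) (s t : ℝ) : flow M (s + t) = (flow M s).comp (flow M t) := by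
  have hc : Commute (s • M) (t • M) :=
    ((Commute.refl M).smul_left _).smul_right _
  let _ := NormedAlgebra.restrictScalars ℚ ℂ (K →L[ℂ] K)
  unfold flow
  rw [add_smul, NormedSpace.exp_add_of_commute hc]
  rfl

lemma hasDerivAt_flow (M : K →L[ℂ] K) (u : K) (t : ℝ) :
    HasDerivAt (fun s => flow M s u) (M (flow M t u)) t := by
  have h : HasDerivAt (fun s : ℝ => NormedSpace.exp (s • M)) (M * NormedSpace.exp (t • M)) t :=
    hasDerivAt_exp_smul_const' M t
  exact ((ContinuousLinearMap.apply ℂ K u).restrictScalars ℝ).hasFDerivAt.comp_hasDerivAt t h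

lemma hasDerivAt_norm_sq_flow (M : K →L[ℂ] K) (u : K) (t : ℝ) :
    HasDerivAt (fun s => ‖flow M s u‖ ^ 2)
      (2 * (inner ℂ (flow M t u) (M (flow M t u))).re) t :=
  hasDerivAt_norm_sq (hasDerivAt_flow M u t)

lemma norm_flow_apply_le {M : K →L[ℂ] K} (hM : ∀ u, (inner ℂ u (M u)).re ≤ 0) (u : K) {t : ℝ}
    (ht : 0 ≤ t) : ‖flow M t u‖ ≤ ‖u‖ := by
  have hanti : Antitone fun s => ‖flow M s u‖ ^ 2 :=
    antitone_of_hasDerivAt_nonpos (fun s => hasDerivAt_norm_sq_flow M u s) fun s => by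
      have := hM (flow M s u); simp only [Pi.zero_apply]; linarith
  have h := hanti ht
  simp only [flow_zero, ContinuousLinearMap.id_apply] at h
  exact (pow_le_pow_iff_left₀ (norm_nonneg _) (norm_nonneg _) two_ne_zero).1 h

lemma norm_flow_le {M : K →L[ℂ] K} (hM : ∀ u, (inner ℂ u (M u)).re ≤ 0) {t : ℝ}
    (ht : 0 ≤ t) : ‖flow M t‖ ≤ 1 :=
  ContinuousLinearMap.opNorm_le_bound _ zero_le_one fun u => by
    rw [one_mul]; exact norm_flow_apply_le hM u ht

end DissipativeFlow

/-! ### The operators on a single spatial Fourier mode -/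

/-- Fourier coefficients in the velocity angle. -/
abbrev Seq : Type := lp (fun _ : ℤ => ℂ) 2

lemma hasSum_shift (m : ℤ) (h : Seq) : HasSum (fun k => ‖h (k - m)‖ ^ 2) (‖h‖ ^ 2) :=
  (Equiv.subRight m).hasSum_iff.2 (hasSum_norm_sq h)

/-- The family `(h_{k-m})_k`. -/
def shiftFun (m : ℤ) (h : Seq) : Seq :=
  ⟨fun k => h (k - m), memℓp_two_iff.2 (hasSum_shift m h).summable⟩

lemma norm_shiftFun (m : ℤ) (h : Seq) : ‖shiftFun m h‖ = ‖h‖ :=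
  (pow_left_inj₀ (norm_nonneg _) (norm_nonneg _) two_ne_zero).1
    ((hasSum_norm_sq (shiftFun m h)).unique (hasSum_shift m h))

/-- The shift `(h_k) ↦ (h_{k-m})`. -/
def shift (m : ℤ) : Seq →L[ℂ] Seq :=
  LinearMap.mkContinuous
    { toFun := shiftFun m
      map_add' := fun _ _ => rfl
      map_smul' := fun _ _ => rfl } 1 fun h => by
        rw [one_mul]; exact (norm_shiftFun m h).le

lemma norm_shift_apply (m : ℤ) (h : Seq) : ‖shift m h‖ = ‖h‖ := norm_shiftFun m h

@[simp] lemma shift_apply (m : ℤ) (h : Seq) (k : ℤ) : shift m h k = h (k - m) := rfl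

lemma inner_shift (m : ℤ) (g h : Seq) :
    inner ℂ (shift m g) h = inner ℂ g (shift (-m) h) := by
  have h1 := (Equiv.addRight m).hasSum_iff.2 (lp.hasSum_inner (𝕜 := ℂ) (shift m g) h)
  refine h1.unique ?_
  convert! lp.hasSum_inner (𝕜 := ℂ) g (shift (-m) h) using 1
  funext k
  simp [shift_apply]

/-- Multiplication by `z e^{iφ} + z̄ e^{-iφ}` on the side of the Fourier coefficients. -/
def trans (z : ℂ) : Seq →L[ℂ] Seq := z • shift 1 + conj z • shift (-1)

lemma trans_apply (z : ℂ) (h : Seq) (k : ℤ) :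
    trans z h k = z * h (k - 1) + conj z * h (k + 1) := by
  change z * h (k - 1) + conj z * h (k - -1) = _
  rw [sub_neg_eq_add]

lemma inner_trans (z : ℂ) (g h : Seq) :
    inner ℂ (trans z g) h = inner ℂ g (trans z h) := by
  simp only [trans, add_apply, FunLike.coe_smul, Pi.smul_apply, inner_add_left, inner_add_right,
    inner_smul_left, inner_smul_right, inner_shift, neg_neg, Complex.conj_conj]
  ring

/-- `trans z` is symmetric, so its multiple by `i` is skew: transport neither creates nor destroys
energy, and all dissipation comes from collisions. -/
lemma re_inner_I_trans (z : ℂ) (h : Seq) : (inner ℂ h (Complex.I • trans z h)).re = 0 := by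
  have h1 : conj (inner ℂ h (trans z h)) = inner ℂ h (trans z h) := by
    rw [inner_conj_symm, inner_trans]
  have h2 := Complex.conj_eq_iff_im.1 h1
  rw [inner_smul_right]
  simp [h2]

lemma norm_trans_le (z : ℂ) (h : Seq) : ‖trans z h‖ ≤ 2 * ‖z‖ * ‖h‖ := by
  calc ‖trans z h‖ ≤ ‖z • shift 1 h‖ + ‖conj z • shift (-1) h‖ := norm_add_le _ _
    _ ≤ ‖z‖ * ‖h‖ + ‖z‖ * ‖h‖ := by
        rw [norm_smul, norm_smul, RCLike.norm_conj, norm_shift_apply, norm_shift_apply]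
    _ = 2 * ‖z‖ * ‖h‖ := by ring

/-- Projection onto the velocity-independent part of a mode. -/
def meanPart : Seq →L[ℂ] Seq :=
  ((lpEval ℂ (0 : ℤ)).smulRight (lp.single 2 (0 : ℤ) (1 : ℂ) : Seq))

lemma meanPart_apply (h : Seq) (k : ℤ) : meanPart h k = if k = 0 then h 0 else 0 := by
  change h 0 * (lp.single 2 (0 : ℤ) (1 : ℂ) : Seq) k = _
  rw [lp.single_apply]
  split_ifs with hk
  · subst hk; simp
  · simp [hk]

/-- The collision operator on a mode. -/
def coll : Seq →L[ℂ] Seq := ContinuousLinearMap.id ℂ Seq - meanPart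

lemma coll_apply (h : Seq) (k : ℤ) : coll h k = if k = 0 then 0 else h k := by
  change h k - meanPart h k = _
  rw [meanPart_apply]
  split_ifs with hk
  · subst hk; simp
  · simp

lemma hasSum_coll (h : Seq) :
    HasSum (fun k : ℤ => if k = 0 then 0 else ‖h k‖ ^ 2) (‖coll h‖ ^ 2) := by
  convert! hasSum_norm_sq (coll h) using 1
  funext k
  rw [coll_apply]
  split_ifs <;> simp

lemma norm_coll_sq (h : Seq) : ‖coll h‖ ^ 2 = ‖h‖ ^ 2 - ‖h 0‖ ^ 2 := by
  have h1 := (hasSum_norm_sq h).sub (hasSum_ite_eq (0 : ℤ) (‖h 0‖ ^ 2))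
  refine (hasSum_coll h).unique ?_
  convert! h1 using 1
  funext k
  split_ifs with hk
  · subst hk; simp
  · simp

lemma norm_coll_le (h : Seq) : ‖coll h‖ ≤ ‖h‖ := by
  refine (pow_le_pow_iff_left₀ (norm_nonneg _) (norm_nonneg _) two_ne_zero).1 ?_
  rw [norm_coll_sq]
  nlinarith [sq_nonneg ‖h 0‖]

lemma inner_coll (g h : Seq) : inner ℂ (coll g) h = inner ℂ g (coll h) := by
  rw [lp.inner_eq_tsum, lp.inner_eq_tsum]
  refine tsum_congr fun k => ?_
  rw [coll_apply, coll_apply]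
  split_ifs <;> simp

lemma coll_coll (h : Seq) : coll (coll h) = coll h := by
  refine lp.ext (funext fun k => ?_)
  rw [coll_apply, coll_apply]
  split_ifs <;> rfl

lemma re_inner_coll (h : Seq) : (inner ℂ h (coll h)).re = ‖coll h‖ ^ 2 := by
  rw [← coll_coll, ← inner_coll, coll_coll]
  exact (norm_sq_eq_re_inner (𝕜 := ℂ) (coll h)).symm

lemma sum_five_le_norm_sq (h : Seq) :
    ‖h 0‖ ^ 2 + (‖h 1‖ ^ 2 + ‖h (-1)‖ ^ 2) + (‖h 2‖ ^ 2 + ‖h (-2)‖ ^ 2) ≤ ‖h‖ ^ 2 := by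
  have h1 := sum_le_hasSum ({0, 1, -1, 2, -2} : Finset ℤ) (fun _ _ => by positivity)
    (hasSum_norm_sq h)
  refine le_trans (le_of_eq ?_) h1
  rw [Finset.sum_insert (by decide), Finset.sum_insert (by decide), Finset.sum_insert (by decide),
    Finset.sum_insert (by decide), Finset.sum_singleton]
  ring

/-- The generator `-(R + i n·v)` on a mode. -/
def modeGen (z : ℂ) : Seq →L[ℂ] Seq := -(coll + Complex.I • trans z)

lemma modeGen_apply (z : ℂ) (h : Seq) : modeGen z h = -(coll h + Complex.I • trans z h) := rfl

lemma modeGen_apply_apply (z : ℂ) (h : Seq) (k : ℤ) :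
    modeGen z h k = -((if k = 0 then 0 else h k)
      + Complex.I * (z * h (k - 1) + conj z * h (k + 1))) := by
  rw [← coll_apply, ← trans_apply]; rfl

lemma re_inner_modeGen (z : ℂ) (h : Seq) : (inner ℂ h (modeGen z h)).re = -‖coll h‖ ^ 2 := by
  rw [modeGen_apply, inner_neg_right, inner_add_right, Complex.neg_re, Complex.add_re,
    re_inner_I_trans, re_inner_coll, add_zero]

lemma modeGen_dissipative (z : ℂ) (h : Seq) : (inner ℂ h (modeGen z h)).re ≤ 0 := by
  rw [re_inner_modeGen]; nlinarith [sq_nonneg ‖coll h‖]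

/-! ### The coercivity estimate on a mode -/

/-- By the reverse triangle inequality both right-hand sides are at least `(|p| - |q|)² / 4`. The
two weights are tuned for `mode_coercive`, and with them the quadratic form in `|p|, |q|` is
degenerate, so nothing is lost. -/
lemma norm_sq_add_ge {z : ℂ} (hz : 1 / 4 ≤ ‖z‖ ^ 2) (p q : ℂ) :
    (3 - √5) / 4 * ‖p‖ ^ 2 - (√5 + 1) / 4 * ‖q‖ ^ 2 ≤ ‖z * p + conj z * q‖ ^ 2 ∧
      (3 - √5) / 4 * ‖p‖ ^ 2 - (√5 + 1) / 4 * ‖q‖ ^ 2 ≤ ‖z * q + conj z * p‖ ^ 2 := by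
  have h5 : √5 ^ 2 = 5 := Real.sq_sqrt (by norm_num)
  have h2 : 2 < √5 := by
    rw [Real.lt_sqrt (by norm_num)]; norm_num
  have key : (3 - √5) / 4 * ‖p‖ ^ 2 - (√5 + 1) / 4 * ‖q‖ ^ 2 ≤ (‖z‖ * ‖p‖ - ‖z‖ * ‖q‖) ^ 2 := by
    have e1 : (3 - √5) / 4 * ‖p‖ ^ 2 - (√5 + 1) / 4 * ‖q‖ ^ 2
        ≤ 1 / 4 * (‖p‖ - ‖q‖) ^ 2 := by
      -- The difference of the two sides is a quarter of this square, because `(√5 + 2)(√5 - 2) =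
      -- 1`.
      have : 0 ≤ (√5 + 2) * ((√5 - 2) * ‖p‖ - ‖q‖) ^ 2 := by positivity
      nlinarith
    have e2 : 1 / 4 * (‖p‖ - ‖q‖) ^ 2 ≤ ‖z‖ ^ 2 * (‖p‖ - ‖q‖) ^ 2 := by gcongr
    nlinarith
  have hc : ‖conj z‖ = ‖z‖ := RCLike.norm_conj z
  constructor
  · refine key.trans ?_
    have := abs_norm_sub_norm_le (z * p) (-(conj z * q))
    rw [norm_neg, norm_mul, norm_mul, hc, sub_neg_eq_add] at this
    rw [← sq_abs]
    exact pow_le_pow_left₀ (abs_nonneg _) this 2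
  · refine key.trans ?_
    have := abs_norm_sub_norm_le (conj z * p) (-(z * q))
    rw [norm_neg, norm_mul, norm_mul, hc, sub_neg_eq_add, add_comm] at this
    rw [← sq_abs]
    exact pow_le_pow_left₀ (abs_nonneg _) this 2

/-- At each `k ≠ 0` the coefficient nearer to the centre is counted with the gain `(3 - √5)/4` and
the outer one with the loss `(√5 + 1)/4`. After summation `|h 0|²` is gained from both `k = 1` and
`k = -1`, total `(3 - √5)/2`. For `|m| ≥ 2` collisions, gain and loss add up to `1 + (3 - √5)/4 -
(√5 + 1)/4`, again `(3 - √5)/2`. For `|m| = 1` there is no loss. This balance fixes the weights. -/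
lemma mode_coercive {z : ℂ} (hz : 1 / 4 ≤ ‖z‖ ^ 2) (h : Seq) :
    (3 - √5) / 2 * ‖h‖ ^ 2 ≤ ‖coll h‖ ^ 2 + ‖coll (trans z h)‖ ^ 2 := by
  have h5 : √5 ^ 2 = 5 := Real.sq_sqrt (by norm_num)
  have h2 : 2 < √5 := by
    rw [Real.lt_sqrt (by norm_num)]; norm_num
  have h3 : √5 < 3 := by
    rw [Real.sqrt_lt' (by norm_num)]; norm_num
  set ρ : ℤ → ℝ := fun k => ‖h k‖ ^ 2 with hρ
  have hρ0 : ∀ k, 0 ≤ ρ k := fun k => by positivity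
  have hsum := hasSum_norm_sq h
  have hI : ∀ (c : ℝ) (s : Set ℤ), Summable (s.indicator fun k => c * ρ k) := fun c s =>
    (hsum.summable.mul_left c).indicator s
  -- `F1`, `F2` hold the gains and losses from `k ≥ 1`, and `F3`, `F4` those from `k ≤ -1`, all
  -- indexed by the coefficient of `h` concerned. Thus `k - 1 ≥ 0` and `k + 1 ≥ 2` become the ranges
  -- of `F1` and `F2`.
  set F1 := (Set.Ici (0 : ℤ)).indicator fun k => (3 - √5) / 4 * ρ k
  set F2 := (Set.Ici (2 : ℤ)).indicator fun k => (√5 + 1) / 4 * ρ k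
  set F3 := (Set.Iic (0 : ℤ)).indicator fun k => (3 - √5) / 4 * ρ k
  set F4 := (Set.Iic (-2 : ℤ)).indicator fun k => (√5 + 1) / 4 * ρ k
  have s1 := (hI _ _ : Summable F1).hasSum
  have s2 := (hI _ _ : Summable F2).hasSum
  have s3 := (hI _ _ : Summable F3).hasSum
  have s4 := (hI _ _ : Summable F4).hasSum
  have hR := hasSum_coll h
  have lower := hasSum_le (f := fun k => (3 - √5) / 2 * ρ k)
    (g := fun k => (if k = 0 then 0 else ρ k) + (F1 k - F2 k + F3 k - F4 k)) (fun k => ?_)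
    (hsum.mul_left _) (hR.add (((s1.sub s2).add s3).sub s4))
  -- Reindexing by `k ∓ 1` regroups the same sums by the coefficient of `trans z h` that produced
  -- them.
  · have t1 := (Equiv.subRight (1 : ℤ)).hasSum_iff.2 s1
    have t2 := (Equiv.addRight (1 : ℤ)).hasSum_iff.2 s2
    have t3 := (Equiv.addRight (1 : ℤ)).hasSum_iff.2 s3
    have t4 := (Equiv.subRight (1 : ℤ)).hasSum_iff.2 s4
    have upper := hasSum_le (fun k => ?_) (((t1.sub t2).add t3).sub t4) (hasSum_coll (trans z h))
    · linarith
    · simp only [Function.comp_apply, Equiv.subRight_apply, Equiv.coe_addRight,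
        Set.indicator_apply, Set.mem_Ici, Set.mem_Iic, trans_apply]
      have hn := norm_sq_add_ge hz
      rcases lt_trichotomy k 0 with hk | hk | hk
      · rw [if_neg (by omega), if_neg (by omega), if_pos (by omega), if_pos (by omega),
          if_neg hk.ne]
        have := (hn (h (k + 1)) (h (k - 1))).2
        simp only [hρ]; linarith
      · subst hk; norm_num
      · rw [if_pos (by omega), if_pos (by omega), if_neg (by omega), if_neg (by omega),
          if_neg hk.ne']
        have := (hn (h (k - 1)) (h (k + 1))).1
        simp only [hρ]; linarith
  · have hk0 := hρ0 k
    simp only [F1, F2, F3, F4, Set.indicator_apply, Set.mem_Ici, Set.mem_Iic]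
    split_ifs <;> first | omega | nlinarith

/-! ### Decay of a single mode -/

lemma abs_le_add_of_sq_le {t p q : ℝ} (hp : 0 ≤ p) (hq : 0 ≤ q) (h : t ^ 2 ≤ 4 * p * q) :
    |t| ≤ p + q :=
  abs_le_of_sq_le_sq (by nlinarith [sq_nonneg (p - q)]) (by positivity)

/-- The functional that couples the mean of a mode to its flux. -/
def coupling (z : ℂ) (h : Seq) : ℝ :=
  (conj (h 0) * (Complex.I * (conj z * h 1 + z * h (-1)))).re / (2 * ‖z‖ ^ 2)

/-- The derivative of `coupling` along the flow. -/
def couplingDeriv (z : ℂ) (h : Seq) : ℝ :=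
  ‖h 0‖ ^ 2 + (conj (h 0) * (conj z ^ 2 * h 2 + z ^ 2 * h (-2))).re / (2 * ‖z‖ ^ 2)
    - coupling z h - ‖conj z * h 1 + z * h (-1)‖ ^ 2 / (2 * ‖z‖ ^ 2)

lemma hasDerivAt_flow_apply (z : ℂ) (u : Seq) (t : ℝ) (k : ℤ) :
    HasDerivAt (fun s => flow (modeGen z) s u k) (modeGen z (flow (modeGen z) t u) k) t :=
  ((lpEval ℂ k).restrictScalars ℝ : Seq →L[ℝ] ℂ).hasFDerivAt.comp_hasDerivAt t
    (hasDerivAt_flow (modeGen z) u t)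

/-- The flow sends `h 0` into `h 1` and `h (-1)` with amplitudes `-i z` and `-i z̄`. Fed back into
the flux these give `2|z|² h 0`, and the normalization by `2|z|²` turns this into the good term `|h
0|²`, of size independent of the frequency. -/
lemma hasDerivAt_coupling {z : ℂ} (hz : z ≠ 0) (u : Seq) (t : ℝ) :
    HasDerivAt (fun s => coupling z (flow (modeGen z) s u))
      (couplingDeriv z (flow (modeGen z) t u)) t := by
  have hz2 : (0 : ℝ) < ‖z‖ ^ 2 := by positivity
  have d0 := hasDerivAt_flow_apply z u t 0
  have d1 := hasDerivAt_flow_apply z u t 1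
  have d2 := hasDerivAt_flow_apply z u t (-1)
  have dc : HasDerivAt (fun s => conj (flow (modeGen z) s u 0))
      (conj (modeGen z (flow (modeGen z) t u) 0)) t :=
    (Complex.conjCLE : ℂ →L[ℝ] ℂ).hasFDerivAt.comp_hasDerivAt t d0
  have d3 := (dc.mul (((d1.const_mul (conj z)).add (d2.const_mul z)).const_mul Complex.I))
  have d4 := (Complex.reCLM.hasFDerivAt.comp_hasDerivAt t d3).div_const (2 * ‖z‖ ^ 2)
  refine d4.congr_deriv ?_
  simp only [Pi.add_apply]
  -- What remains is a polynomial identity in the five coefficients `h 0`, `h (±1)`, `h (±2)`.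
  generalize flow (modeGen z) t u = h
  rw [couplingDeriv, coupling, div_eq_iff (by positivity)]
  field_simp
  change Complex.re _ = _
  simp only [modeGen_apply_apply, sq (conj z), sq z]
  simp only [← Complex.normSq_eq_norm_sq, Complex.normSq_apply]
  norm_num
  ring

/-- This isolates the real inequalities used by both decay estimates. Here `a` and `b` are the
energies at `k = ±1` and `k = ±2`, `w` is the term linking `h 0` to `h (±2)`, and `y` is the squared
flux. The bounds on `w` and `y` are scale-free in `z`. The one on `coupling` gains a factor
`1/|z|²`, which is where `|z|² ≥ 1/4` enters quantitatively. -/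
lemma coupling_bounds {z : ℂ} (hz : 1 / 4 ≤ ‖z‖ ^ 2) (h : Seq) :
    ∃ a b w y : ℝ, 0 ≤ a ∧ 0 ≤ b ∧ a + b ≤ ‖coll h‖ ^ 2 ∧
      couplingDeriv z h = ‖h 0‖ ^ 2 + w - coupling z h - y ∧
      coupling z h ^ 2 ≤ 2 * ‖h 0‖ ^ 2 * a ∧ w ^ 2 ≤ ‖h 0‖ ^ 2 * b / 2 ∧ 0 ≤ y ∧ y ≤ a := by
  have h5 := sum_five_le_norm_sq h
  set N := ‖z‖ ^ 2 with hN
  have hN0 : 0 < N := by linarith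
  have hc : ‖conj z‖ = ‖z‖ := RCLike.norm_conj z
  have hU : ‖conj z * h 1 + z * h (-1)‖ ^ 2 ≤ 2 * N * (‖h 1‖ ^ 2 + ‖h (-1)‖ ^ 2) := by
    have h1 : ‖conj z * h 1 + z * h (-1)‖ ≤ ‖z‖ * (‖h 1‖ + ‖h (-1)‖) := by
      refine (norm_add_le _ _).trans (le_of_eq ?_)
      rw [norm_mul, norm_mul, hc]; ring
    refine (pow_le_pow_left₀ (norm_nonneg _) h1 2).trans ?_
    rw [mul_pow, ← hN, mul_comm 2 N, mul_assoc]
    gcongr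
    nlinarith [sq_nonneg (‖h 1‖ - ‖h (-1)‖)]
  have hW : ‖conj z ^ 2 * h 2 + z ^ 2 * h (-2)‖ ^ 2 ≤ 2 * N ^ 2 * (‖h 2‖ ^ 2 + ‖h (-2)‖ ^ 2) := by
    have h1 : ‖conj z ^ 2 * h 2 + z ^ 2 * h (-2)‖ ≤ N * (‖h 2‖ + ‖h (-2)‖) := by
      refine (norm_add_le _ _).trans (le_of_eq ?_)
      rw [norm_mul, norm_mul, norm_pow, norm_pow, hc]; ring
    refine (pow_le_pow_left₀ (norm_nonneg _) h1 2).trans ?_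
    rw [mul_pow, mul_comm 2 (N ^ 2), mul_assoc]
    gcongr
    nlinarith [sq_nonneg (‖h 2‖ - ‖h (-2)‖)]
  have hre : ∀ v w : ℂ, (conj v * w).re ^ 2 ≤ ‖v‖ ^ 2 * ‖w‖ ^ 2 := fun v w => by
    rw [← mul_pow, ← RCLike.norm_conj v, ← norm_mul, ← sq_abs]
    exact pow_le_pow_left₀ (abs_nonneg _) (Complex.abs_re_le_norm _) 2
  refine ⟨‖h 1‖ ^ 2 + ‖h (-1)‖ ^ 2, ‖h 2‖ ^ 2 + ‖h (-2)‖ ^ 2, _, _, by positivity, by positivity,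
    ?_, rfl, ?_, ?_, by positivity, ?_⟩
  · rw [norm_coll_sq]; linarith
  · rw [coupling, ← hN, div_pow, div_le_iff₀ (by positivity)]
    have h1 := hre (h 0) (Complex.I * (conj z * h 1 + z * h (-1)))
    rw [norm_mul Complex.I, Complex.norm_I, one_mul] at h1
    have h2 := mul_le_mul_of_nonneg_left hU (sq_nonneg ‖h 0‖)
    have h3 : 0 ≤ ‖h 0‖ ^ 2 * (‖h 1‖ ^ 2 + ‖h (-1)‖ ^ 2) := by positivity
    nlinarith [mul_le_mul_of_nonneg_left hz (mul_nonneg hN0.le h3)]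
  · rw [← hN, div_pow, div_le_iff₀ (by positivity)]
    have h1 := hre (h 0) (conj z ^ 2 * h 2 + z ^ 2 * h (-2))
    have h2 := mul_le_mul_of_nonneg_left hW (sq_nonneg ‖h 0‖)
    linarith
  · rw [← hN, div_le_iff₀ (by positivity)]
    linarith

lemma norm_sq_eq_add_coll (h : Seq) : ‖h‖ ^ 2 = ‖h 0‖ ^ 2 + ‖coll h‖ ^ 2 := by
  rw [norm_coll_sq]; ring

lemma hasDerivAt_norm_sq_modeGen (z : ℂ) (u : Seq) (t : ℝ) :
    HasDerivAt (fun s => ‖flow (modeGen z) s u‖ ^ 2)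
      (-2 * ‖coll (flow (modeGen z) t u)‖ ^ 2) t := by
  have h := hasDerivAt_norm_sq_flow (modeGen z) u t
  rw [re_inner_modeGen] at h
  exact h.congr_deriv (by ring)

/-- The factor `7/10` is small enough that `7/10 |coupling|` stays below half the energy, and large
enough that the derivative controls `|h 0|²` at rate `1/5`. -/
lemma mode_lyapunov {z : ℂ} (hz : 1 / 4 ≤ ‖z‖ ^ 2) (h : Seq) :
    -2 * ‖coll h‖ ^ 2 - 7 / 10 * couplingDeriv z h
        ≤ -(1 / 5) * (‖h‖ ^ 2 - 7 / 10 * coupling z h) ∧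
      1 / 2 * ‖h‖ ^ 2 ≤ ‖h‖ ^ 2 - 7 / 10 * coupling z h ∧
      ‖h‖ ^ 2 - 7 / 10 * coupling z h ≤ 3 / 2 * ‖h‖ ^ 2 := by
  obtain ⟨a, b, w, y, ha, hb, hab, hD, hq, hw, hy, hya⟩ := coupling_bounds hz h
  rw [hD, norm_sq_eq_add_coll h]
  set q := coupling z h
  set X := ‖h 0‖ ^ 2 with hX
  set r := ‖coll h‖ ^ 2
  have hX0 : 0 ≤ X := by positivity
  have hXa : 0 ≤ X * a := by positivity
  have hXb : 0 ≤ X * b := by positivity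
  have b1 : |q| ≤ 5 / 7 * X + 5 / 7 * a :=
    abs_le_add_of_sq_le (by positivity) (by positivity) (by nlinarith)
  -- The coefficient `14/25 = 7/10 - 7/50` collects the coupling from its own derivative and from
  -- the right-hand side. The shares `2/5` and `1/10` of `X` here and in `b3` use up exactly the
  -- available `7/10 - 1/5 = 1/2`.
  have b2 : |14 / 25 * q| ≤ 2 / 5 * X + 2 / 5 * a :=
    abs_le_add_of_sq_le (by positivity) (by positivity) (by nlinarith)
  have b3 : |7 / 10 * w| ≤ 1 / 10 * X + 7 / 10 * b :=
    abs_le_add_of_sq_le (by positivity) (by positivity) (by nlinarith)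
  rw [abs_le] at b1 b2 b3
  refine ⟨?_, ?_, ?_⟩ <;> linarith

/-- Exponential decay of a mode with constant `√3`. -/
lemma norm_flow_sq_le {z : ℂ} (hz : 1 / 4 ≤ ‖z‖ ^ 2) (u : Seq) {t : ℝ} (ht : 0 ≤ t) :
    ‖flow (modeGen z) t u‖ ^ 2 ≤ 3 * Real.exp (-(1 / 5) * t) * ‖u‖ ^ 2 := by
  have hz0 : z ≠ 0 := by rintro rfl; norm_num at hz
  set E : ℝ → ℝ := fun s =>
    ‖flow (modeGen z) s u‖ ^ 2 - 7 / 10 * coupling z (flow (modeGen z) s u) with hE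
  have hd : ∀ s, HasDerivAt (fun s => Real.exp (1 / 5 * s) * E s)
      (Real.exp (1 / 5 * s) * (1 / 5) * E s + Real.exp (1 / 5 * s) *
        (-2 * ‖coll (flow (modeGen z) s u)‖ ^ 2
          - 7 / 10 * couplingDeriv z (flow (modeGen z) s u))) s := fun s => by
    have h1 : HasDerivAt (fun s : ℝ => Real.exp (1 / 5 * s)) (Real.exp (1 / 5 * s) * (1 / 5)) s :=
      ((hasDerivAt_id s).const_mul (1 / 5)).exp.congr_deriv (by simp)
    exact h1.mul ((hasDerivAt_norm_sq_modeGen z u s).sub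
      ((hasDerivAt_coupling hz0 u s).const_mul (7 / 10)))
  have hanti := antitone_of_hasDerivAt_nonpos hd fun s => by
    have h1 := mul_le_mul_of_nonneg_left (mode_lyapunov hz (flow (modeGen z) s u)).1
      (Real.exp_pos (1 / 5 * s)).le
    simp only [Pi.zero_apply, hE]
    linarith
  have h1 := hanti ht
  have h2 := (mode_lyapunov hz (flow (modeGen z) t u)).2.1
  have h3 := (mode_lyapunov hz u).2.2
  simp only [hE, flow_zero, ContinuousLinearMap.id_apply, mul_zero, Real.exp_zero, one_mul] at h1
  have h4 : Real.exp (1 / 5 * t) * (1 / 2 * ‖flow (modeGen z) t u‖ ^ 2) ≤ 3 / 2 * ‖u‖ ^ 2 :=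
    (mul_le_mul_of_nonneg_left h2 (Real.exp_pos _).le).trans (h1.trans h3)
  have h5 : Real.exp (-(1 / 5) * t) * Real.exp (1 / 5 * t) = 1 := by
    rw [← Real.exp_add]; simp
  have h6 := mul_le_mul_of_nonneg_left h4 (Real.exp_pos (-(1 / 5) * t)).le
  rw [← mul_assoc, h5] at h6
  linarith

/-- Short-time decay of a mode, uniformly in the frequency. -/
lemma norm_flow_le_short {z : ℂ} (hz : 1 / 4 ≤ ‖z‖ ^ 2) (u : Seq) {t : ℝ} (ht : 0 ≤ t)
    (ht1 : t ≤ 1) : ‖flow (modeGen z) t u‖ ≤ (1 - 1 / 24000 * t ^ 3) * ‖u‖ := by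
  have hz0 : z ≠ 0 := by rintro rfl; norm_num at hz
  rcases ht.eq_or_lt with rfl | ht0
  · simp [flow_zero]
  have ht3 : t ^ 3 ≤ 1 := pow_le_one₀ ht ht1
  have key : (1 + 1 / 6000 * t ^ 3) * ‖flow (modeGen z) t u‖ ^ 2 ≤ ‖u‖ ^ 2 := by
    -- The functional is `(1 + A) ‖f‖² - g² coupling / 100`. The weight `g` vanishes at `0` and `t`,
    -- so the coupling is absent at both ends. `A` is the primitive of `g² / 200` with `A 0 = 0`,
    -- and `∫₀ᵗ g² = t³ / 30` gives `A t = t³ / 6000`. The weight is a square so that its derivative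
    -- `2 g g'` keeps a factor `g` with which to absorb the coupling into `g² |h 0|²`.
    set A : ℝ → ℝ := fun s => 1 / 200 * ((s ^ 3 / 3 * t ^ 2 - s ^ 4 / 2 * t + s ^ 5 / 5) / t ^ 2)
    set g : ℝ → ℝ := fun s => s * (t - s) / t
    have hA : ∀ s, HasDerivAt A (1 / 200 * g s ^ 2) s := fun s => by
      have h1 := (((((hasDerivAt_pow 3 s).div_const 3).mul_const (t ^ 2)).sub
        (((hasDerivAt_pow 4 s).div_const 2).mul_const t)).add
        ((hasDerivAt_pow 5 s).div_const 5)).div_const (t ^ 2) |>.const_mul (1 / 200)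
      refine h1.congr_deriv ?_
      simp only [g]
      field_simp
      norm_num
      ring
    have hg : ∀ s, HasDerivAt g ((t - 2 * s) / t) s := fun s => by
      have h1 := ((hasDerivAt_id s).mul ((hasDerivAt_id s).const_sub t)).div_const t
      refine h1.congr_deriv ?_
      simp only [id]
      ring
    have hd : ∀ s, HasDerivAt (fun s => (1 + A s) * ‖flow (modeGen z) s u‖ ^ 2
        - 1 / 100 * g s ^ 2 * coupling z (flow (modeGen z) s u))
        (1 / 200 * g s ^ 2 * ‖flow (modeGen z) s u‖ ^ 2
          + (1 + A s) * (-2 * ‖coll (flow (modeGen z) s u)‖ ^ 2)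
          - (1 / 100 * (2 * g s * ((t - 2 * s) / t)) * coupling z (flow (modeGen z) s u)
          + 1 / 100 * g s ^ 2 * couplingDeriv z (flow (modeGen z) s u))) s := fun s => by
      have h1 := ((hA s).const_add 1).mul (hasDerivAt_norm_sq_modeGen z u s)
      have h2 := (((hg s).pow 2).const_mul (1 / 100)).mul (hasDerivAt_coupling hz0 u s)
      refine (h1.sub h2).congr_deriv ?_
      simp
    have hanti : AntitoneOn (fun s => (1 + A s) * ‖flow (modeGen z) s u‖ ^ 2
        - 1 / 100 * g s ^ 2 * coupling z (flow (modeGen z) s u)) (Set.Icc 0 t) := by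
      refine antitoneOn_of_deriv_nonpos (convex_Icc 0 t)
        (fun s _ => (hd s).continuousAt.continuousWithinAt)
        (fun s _ => (hd s).differentiableAt.differentiableWithinAt) fun s hs => ?_
      rw [interior_Icc] at hs
      obtain ⟨hs0, hst⟩ := hs
      rw [(hd s).deriv]
      generalize flow (modeGen z) s u = h
      obtain ⟨a, b, w, y, ha, hb, hab, hD, hq, hw, hy, hya⟩ := coupling_bounds hz h
      rw [hD, norm_sq_eq_add_coll h]
      have hA0 : 0 ≤ A s := by
        have : 0 ≤ s ^ 3 / 3 * t ^ 2 - s ^ 4 / 2 * t + s ^ 5 / 5 := by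
          have : s ^ 3 / 3 * t ^ 2 - s ^ 4 / 2 * t + s ^ 5 / 5
            = s ^ 3 * (1 / 3 * (t - 3 / 4 * s) ^ 2 + 1 / 80 * s ^ 2) := by ring
          rw [this]; positivity
        positivity
      have hg0 : 0 ≤ g s := div_nonneg (mul_nonneg hs0.le (by linarith)) ht
      have hg1 : g s ≤ 1 := by
        simp only [g]
        rw [div_le_one ht0]
        nlinarith
      have hd1 : |(t - 2 * s) / t| ≤ 1 := by
        rw [abs_div, abs_of_pos ht0, div_le_one ht0, abs_le]
        constructor <;> linarith
      generalize A s = α at hA0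
      generalize g s = γ at hg0 hg1
      generalize (t - 2 * s) / t = δ at hd1
      generalize coupling z h = q at hq
      have hX0 : 0 ≤ ‖h 0‖ ^ 2 := by positivity
      have hr0 : 0 ≤ ‖coll h‖ ^ 2 := by positivity
      generalize ‖h 0‖ ^ 2 = X at hq hw hX0
      generalize ‖coll h‖ ^ 2 = r at hab hr0
      have hγ2 : γ ^ 2 ≤ 1 := pow_le_one₀ hg0 hg1
      have hY0 : 0 ≤ γ ^ 2 * X := by positivity
      have hYa : 0 ≤ γ ^ 2 * X * a := by positivity
      have hYb : 0 ≤ γ ^ 2 * X * b := by positivity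
      have hγq : (γ * q) ^ 2 ≤ 2 * (γ ^ 2 * X * a) := by
        rw [mul_pow]; nlinarith [mul_le_mul_of_nonneg_left hq (sq_nonneg γ)]
      have hγw : (γ * w) ^ 2 ≤ γ ^ 2 * X * b / 2 := by
        rw [mul_pow]; nlinarith [mul_le_mul_of_nonneg_left hw (sq_nonneg γ)]
      -- Of the good term `γ² X / 100`, half pays for the derivative of `A`. The error terms `c1`,
      -- `c2`, `c3` cost `1/400 + 1/800 + 1/800`, which is exactly the other half. Their multiples
      -- of `a` and `b` are absorbed by `-2r`.
      have b1 : |γ * q| ≤ 1 / 8 * (γ ^ 2 * X) + 4 * a :=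
        abs_le_add_of_sq_le (by positivity) (by positivity) (by nlinarith)
      have b2 : |γ * w| ≤ 1 / 8 * (γ ^ 2 * X) + b :=
        abs_le_add_of_sq_le (by positivity) (by positivity) (by nlinarith)
      have c1 : |γ * q * δ| ≤ 1 / 8 * (γ ^ 2 * X) + 4 * a := by
        rw [abs_mul]
        exact (mul_le_of_le_one_right (abs_nonneg _) hd1).trans b1
      have hγabs : |γ| ≤ 1 := by rwa [abs_of_nonneg hg0]
      have c2 : |γ * (γ * w)| ≤ 1 / 8 * (γ ^ 2 * X) + b := by
        rw [abs_mul]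
        exact (mul_le_of_le_one_left (abs_nonneg _) hγabs).trans b2
      have c3 : |γ * (γ * q)| ≤ 1 / 8 * (γ ^ 2 * X) + 4 * a := by
        rw [abs_mul]
        exact (mul_le_of_le_one_left (abs_nonneg _) hγabs).trans b1
      have c4 : γ ^ 2 * y ≤ a := (mul_le_of_le_one_left hy hγ2).trans hya
      have c5 : γ ^ 2 * r ≤ r := mul_le_of_le_one_left hr0 hγ2
      have c6 : 0 ≤ α * r := by positivity
      rw [abs_le] at c1 c2 c3
      nlinarith
    have h1 := hanti (Set.left_mem_Icc.2 ht) (Set.right_mem_Icc.2 ht) ht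
    have e1 : A 0 = 0 := by simp [A]
    have e2 : A t = 1 / 6000 * t ^ 3 := by
      simp only [A]; field_simp; norm_num
    have e3 : g 0 = 0 := by simp [g]
    have e4 : g t = 0 := by simp [g]
    simpa [e1, e2, e3, e4, flow_zero] using h1
  refine (pow_le_pow_iff_left₀ (norm_nonneg _)
    (mul_nonneg (by linarith) (norm_nonneg _)) two_ne_zero).1 ?_
  have hs : 1 ≤ (1 - 1 / 24000 * t ^ 3) ^ 2 * (1 + 1 / 6000 * t ^ 3) := by
    have : 0 ≤ t ^ 3 := by positivity
    generalize t ^ 3 = y at *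
    nlinarith [mul_nonneg this (sub_nonneg.2 ht3), mul_nonneg (mul_nonneg this this) this]
  calc ‖flow (modeGen z) t u‖ ^ 2
      ≤ (1 - 1 / 24000 * t ^ 3) ^ 2 * (1 + 1 / 6000 * t ^ 3) * ‖flow (modeGen z) t u‖ ^ 2 :=
        le_mul_of_one_le_left (by positivity) hs
    _ = (1 - 1 / 24000 * t ^ 3) ^ 2 * ((1 + 1 / 6000 * t ^ 3) * ‖flow (modeGen z) t u‖ ^ 2) := by
        ring
    _ ≤ ((1 - 1 / 24000 * t ^ 3) * ‖u‖) ^ 2 := by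
        rw [mul_pow]; gcongr

/-- On the zero frequency the velocity-independent part is conserved. -/
lemma flow_zero_apply_zero (u : Seq) (t : ℝ) : flow (modeGen 0) t u 0 = u 0 := by
  have hd : ∀ s, HasDerivAt (fun s => flow (modeGen 0) s u 0) 0 s := fun s => by
    refine (hasDerivAt_flow_apply 0 u s 0).congr_deriv ?_
    simp [modeGen_apply_apply]
  have h := is_const_of_deriv_eq_zero (fun s => (hd s).differentiableAt) (fun s => (hd s).deriv) t 0
  simpa [flow_zero] using h

lemma norm_flow_zero_le (u : Seq) (hu : u 0 = 0) (t : ℝ) :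
    ‖flow (modeGen 0) t u‖ ^ 2 = Real.exp (-2 * t) * ‖u‖ ^ 2 := by
  have hd : ∀ s, HasDerivAt (fun s => Real.exp (2 * s) * ‖flow (modeGen 0) s u‖ ^ 2) 0 s :=
      fun s => by
    have h1 : HasDerivAt (fun s : ℝ => Real.exp (2 * s)) (Real.exp (2 * s) * 2) s := by
      simpa using ((hasDerivAt_id s).const_mul 2).exp
    refine (h1.mul (hasDerivAt_norm_sq_modeGen 0 u s)).congr_deriv ?_
    rw [norm_coll_sq, flow_zero_apply_zero, hu]
    simp; ring
  have h := is_const_of_deriv_eq_zero (fun s => (hd s).differentiableAt) (fun s => (hd s).deriv) t 0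
  simp only [flow_zero, ContinuousLinearMap.id_apply, mul_zero, Real.exp_zero, one_mul] at h
  rw [← h, ← mul_assoc, ← Real.exp_add]
  simp

/-- Data without velocity dependence lose mass at the slowest possible short-time rate. -/
lemma norm_flow_single_ge (z : ℂ) {t : ℝ} (ht : 0 ≤ t) :
    1 - ‖modeGen z‖ ^ 2 * t ^ 3 ≤ ‖flow (modeGen z) t (lp.single 2 (0 : ℤ) (1 : ℂ))‖ ^ 2 := by
  set u : Seq := lp.single 2 (0 : ℤ) (1 : ℂ) with hu
  set B := ‖modeGen z‖
  have hu1 : ‖u‖ = 1 := by rw [hu, lp.norm_single (by norm_num)]; simp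
  have hcu : coll u = 0 := by
    refine lp.ext (funext fun k => ?_)
    rw [coll_apply]
    split_ifs with hk
    · rfl
    · rw [hu, lp.single_apply]; simp [hk]
  -- Since `coll u = 0`, this also bounds `coll` of the solution by `B s`, so the energy decreases
  -- at rate at most `2 B² s²`.
  have hlip : ∀ s, 0 ≤ s → ‖flow (modeGen z) s u - u‖ ≤ B * s := fun s hs => by
    have h := norm_image_sub_le_of_norm_deriv_le_segment' (f := fun s => flow (modeGen z) s u)
      (C := B) (a := 0) (b := s) (fun x _ => (hasDerivAt_flow (modeGen z) u x).hasDerivWithinAt)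
      (fun x hx => by
        refine ((modeGen z).le_opNorm _).trans ?_
        exact mul_le_of_le_one_right (norm_nonneg _)
          ((norm_flow_apply_le (modeGen_dissipative z) u hx.1).trans_eq hu1)) s
      (Set.right_mem_Icc.2 hs)
    simpa [flow_zero] using h
  have hd : ∀ s, HasDerivAt (fun s => ‖flow (modeGen z) s u‖ ^ 2 + 2 / 3 * B ^ 2 * s ^ 3)
      (-2 * ‖coll (flow (modeGen z) s u)‖ ^ 2 + 2 / 3 * B ^ 2 * (3 * s ^ 2)) s := fun s => by
    have h1 := (hasDerivAt_pow 3 s).const_mul (2 / 3 * B ^ 2)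
    refine ((hasDerivAt_norm_sq_modeGen z u s).add h1).congr_deriv ?_
    norm_num
  have hmono : MonotoneOn (fun s => ‖flow (modeGen z) s u‖ ^ 2 + 2 / 3 * B ^ 2 * s ^ 3)
      (Set.Ici 0) := by
    refine monotoneOn_of_deriv_nonneg (convex_Ici 0)
        (fun s _ => (hd s).continuousAt.continuousWithinAt)
        (fun s _ => (hd s).differentiableAt.differentiableWithinAt) fun s hs => ?_
    rw [interior_Ici] at hs
    rw [(hd s).deriv]
    have h1 : ‖coll (flow (modeGen z) s u)‖ ≤ B * s := by
      have h2 : coll (flow (modeGen z) s u) = coll (flow (modeGen z) s u - u) := by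
        rw [map_sub, hcu, sub_zero]
      rw [h2]
      exact (norm_coll_le _).trans (hlip s (le_of_lt hs))
    have h3 := pow_le_pow_left₀ (norm_nonneg _) h1 2
    rw [mul_pow] at h3
    linarith
  have h := hmono (Set.mem_Ici.2 le_rfl) (Set.mem_Ici.2 ht) ht
  simp only [flow_zero, ContinuousLinearMap.id_apply, hu1] at h
  have : 0 ≤ B ^ 2 * t ^ 3 := by positivity
  linarith

/-! ### Test functions: calculus -/

lemma IsTest.hasDerivAt {ψ : Phase → ℂ} (h : IsTest ψ) (i : Fin 2) (z : Phase) (s : ℝ) :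
    HasDerivAt (fun s : ℝ => ψ (z.1 + Pi.single i (s : T), z.2))
      (Lorentz.dx i ψ (z.1 + Pi.single i (s : T), z.2)) s := by
  obtain ⟨p, rfl⟩ := cover_surjective z
  simp only [cover_add_single]
  rw [dx_cover h]
  have hd : DifferentiableAt ℝ (ψ ∘ cover) (p + s • ((Pi.single i 1, 0) : (Fin 2 → ℝ) × ℝ)) :=
    (ContDiff.differentiable h (by simp)) _
  have h1 : HasDerivAt (fun s : ℝ => p + s • ((Pi.single i 1, 0) : (Fin 2 → ℝ) × ℝ))
      ((Pi.single i 1, 0) : (Fin 2 → ℝ) × ℝ) s := by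
    simpa using ((hasDerivAt_id s).smul_const ((Pi.single i 1, 0) : (Fin 2 → ℝ) × ℝ)).const_add p
  exact hd.hasFDerivAt.comp_hasDerivAt s h1

lemma IsTest.hasDerivAt_zero {ψ : Phase → ℂ} (h : IsTest ψ) (i : Fin 2) (z : Phase) :
    HasDerivAt (fun s : ℝ => ψ (z.1 + Pi.single i (s : T), z.2)) (Lorentz.dx i ψ z) 0 := by
  simpa using h.hasDerivAt i z 0

lemma IsTest.mul {ψ χ : Phase → ℂ} (hψ : IsTest ψ) (hχ : IsTest χ) :
    IsTest fun z => ψ z * χ z :=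
  ContDiff.mul (f := ψ ∘ cover) (g := χ ∘ cover) hψ hχ

lemma IsTest.conj {ψ : Phase → ℂ} (hψ : IsTest ψ) : IsTest fun z => conj (ψ z) :=
  Complex.conjCLE.contDiff.comp (f := ψ ∘ cover) hψ

lemma dx_mul {ψ χ : Phase → ℂ} (hψ : IsTest ψ) (hχ : IsTest χ) (i : Fin 2) (z : Phase) :
    dx i (fun z => ψ z * χ z) z = dx i ψ z * χ z + ψ z * dx i χ z := by
  have h : HasDerivAt (fun s : ℝ => ψ (z.1 + Pi.single i (s : T), z.2)
      * χ (z.1 + Pi.single i (s : T), z.2)) _ 0 :=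
    (hψ.hasDerivAt_zero i z).mul (hχ.hasDerivAt_zero i z)
  refine h.deriv.trans ?_
  simp

lemma dx_conj {ψ : Phase → ℂ} (hψ : IsTest ψ) (i : Fin 2) (z : Phase) :
    dx i (fun z => conj (ψ z)) z = conj (dx i ψ z) :=
  ((Complex.conjCLE : ℂ →L[ℝ] ℂ).hasFDerivAt.comp_hasDerivAt 0 (hψ.hasDerivAt_zero i z)).deriv

lemma vgrad_conj {ψ : Phase → ℂ} (hψ : IsTest ψ) (z : Phase) :
    vgrad (fun z => conj (ψ z)) z = conj (vgrad ψ z) := by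
  simp only [vgrad, dx_conj hψ, map_sum, map_mul, Complex.conj_ofReal]

lemma dx_vel_mul {ψ : Phase → ℂ} (hψ : IsTest ψ) (i j : Fin 2) (z : Phase) :
    dx i (fun z => (vel j z.2 : ℂ) * ψ z) z = vel j z.2 * dx i ψ z :=
  ((hψ.hasDerivAt_zero i z).const_mul (vel j z.2 : ℂ)).deriv

lemma exists_bound {ψ : Phase → ℂ} (h : Continuous ψ) : ∃ C, ∀ z, ‖ψ z‖ ≤ C := by
  obtain ⟨C, hC⟩ := isCompact_univ.exists_bound_of_continuousOn h.continuousOn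
  exact ⟨C, fun z => hC z trivial⟩

lemma integrable_of_continuous {ψ : Phase → ℂ} (h : Continuous ψ) : Integrable ψ :=
  h.integrable_of_hasCompactSupport (HasCompactSupport.of_compactSpace ψ)

instance isAddRightInvariant_volume : (volume : Measure Phase).IsAddRightInvariant :=
  Measure.prod.instIsAddRightInvariant

/-- The integral of a translate does not depend on the translation. Differentiating this constant
under the integral sign gives the claim, and with it integration by parts on the torus. -/
lemma integral_dx {ψ : Phase → ℂ} (h : IsTest ψ) (i : Fin 2) : ∫ z, dx i ψ z = 0 := by
  have htr : ∀ s : ℝ, Continuous fun z : Phase => ((z.1 + Pi.single i (s : T), z.2) : Phase) :=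
    fun s => by fun_prop
  obtain ⟨C, hC⟩ := exists_bound (h.dx i).continuous
  have hc : ∀ s : ℝ, Continuous fun z : Phase => ψ (z.1 + Pi.single i (s : T), z.2) :=
    fun s => h.continuous.comp (htr s)
  have hc' : ∀ s : ℝ, Continuous fun z : Phase => dx i ψ (z.1 + Pi.single i (s : T), z.2) :=
    fun s => (h.dx i).continuous.comp (htr s)
  have hd : HasDerivAt (fun s : ℝ => ∫ z : Phase, ψ (z.1 + Pi.single i (s : T), z.2))
      (∫ z : Phase, dx i ψ (z.1 + Pi.single i ((0 : ℝ) : T), z.2)) 0 :=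
    (hasDerivAt_integral_of_dominated_loc_of_deriv_le (bound := fun _ => C) (s := Set.univ)
      univ_mem (Eventually.of_forall fun s => (hc s).aestronglyMeasurable)
      (integrable_of_continuous (hc 0)) (hc' 0).aestronglyMeasurable
      (ae_of_all _ fun z s _ => hC _) (integrable_const C)
      (ae_of_all _ fun z s _ => h.hasDerivAt i z s)).2
  have hconst : (fun s : ℝ => ∫ z : Phase, ψ (z.1 + Pi.single i (s : T), z.2))
      = fun _ => ∫ z, ψ z := by
    funext s
    have h1 := integral_add_right_eq_self (μ := (volume : Measure Phase)) ψ
      ((Pi.single i (s : T), 0) : Phase)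
    rw [← h1]
    refine integral_congr_ae (ae_of_all _ fun z => ?_)
    change _ = ψ (z.1 + Pi.single i (s : T), z.2 + 0)
    rw [add_zero]
  rw [hconst] at hd
  have h0 := hd.unique (hasDerivAt_const _ _)
  simpa using h0

lemma integral_vgrad {ψ : Phase → ℂ} (h : IsTest ψ) : ∫ z, vgrad ψ z = 0 := by
  unfold vgrad
  rw [integral_finsetSum _ fun i _ => integrable_of_continuous
    ((isTest_vel i).mul (h.dx i)).continuous]
  refine Finset.sum_eq_zero fun i _ => ?_
  rw [← integral_dx ((isTest_vel i).mul h) i]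
  exact integral_congr_ae (ae_of_all _ fun z => (dx_vel_mul h i i z).symm)

lemma vgrad_mul {ψ χ : Phase → ℂ} (hψ : IsTest ψ) (hχ : IsTest χ) (z : Phase) :
    vgrad (fun z => ψ z * χ z) z = vgrad ψ z * χ z + ψ z * vgrad χ z := by
  simp only [vgrad, dx_mul hψ hχ, Finset.sum_mul, Finset.mul_sum, ← Finset.sum_add_distrib]
  exact Finset.sum_congr rfl fun i _ => by ring

/-- A continuous function as an element of `H`. -/
def contLp (ψ : Phase → ℂ) (h : Continuous ψ) : H := ContinuousMap.toLp 2 volume ℂ ⟨ψ, h⟩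

lemma coeFn_contLp {ψ : Phase → ℂ} (h : Continuous ψ) : contLp ψ h =ᵐ[volume] ψ :=
  ContinuousMap.coeFn_toLp (p := 2) (𝕜 := ℂ) volume ⟨ψ, h⟩

lemma inner_contLp {ψ : Phase → ℂ} (h : Continuous ψ) (f : H) :
    inner ℂ (contLp ψ h) f = ∫ z, f z * conj (ψ z) := by
  rw [L2.inner_def]
  refine integral_congr_ae ?_
  filter_upwards [coeFn_contLp h] with z hz
  rw [hz]; rfl

lemma isWeakVGrad_contLp {ψ : Phase → ℂ} (h : IsTest ψ) :
    IsWeakVGrad (contLp ψ h.continuous) (contLp (vgrad ψ) h.vgrad.continuous) := by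
  intro χ hχ
  have h1 : ∫ z, contLp ψ h.continuous z * vgrad χ z = ∫ z, ψ z * vgrad χ z := by
    refine integral_congr_ae ?_
    filter_upwards [coeFn_contLp h.continuous] with z hz
    rw [hz]
  have h2 : ∫ z, contLp (vgrad ψ) h.vgrad.continuous z * χ z = ∫ z, vgrad ψ z * χ z := by
    refine integral_congr_ae ?_
    filter_upwards [coeFn_contLp h.vgrad.continuous] with z hz
    rw [hz]
  have h3 := integral_vgrad (h.mul hχ)
  simp only [vgrad_mul h hχ] at h3
  rw [integral_add (f := fun z => vgrad ψ z * χ z) (g := fun z => ψ z * vgrad χ z)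
    (integrable_of_continuous (h.vgrad.continuous.mul hχ.continuous))
    (integrable_of_continuous (h.continuous.mul hχ.vgrad.continuous))] at h3
  rw [h1, h2, eq_neg_iff_add_eq_zero, add_comm, h3]

/-! ### The Fourier basis of `H` -/

/-- Indices of Fourier modes on phase space. -/
abbrev Idx : Type := (Fin 2 → ℤ) × ℤ

/-- The character `e^{i n·x} e^{i k φ}`. -/
def char (p : Idx) : C(Phase, ℂ) where
  toFun z := (∏ i, fourier (p.1 i) (z.1 i)) * fourier p.2 z.2
  continuous_toFun := by fun_prop

lemma char_apply (p : Idx) (z : Phase) :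
    char p z = (∏ i, fourier (p.1 i) (z.1 i)) * fourier p.2 z.2 := rfl

lemma char_zero (z : Phase) : char 0 z = 1 := by simp [char_apply]

lemma char_add (p q : Idx) (z : Phase) : char (p + q) z = char p z * char q z := by
  simp only [char_apply, Prod.fst_add, Prod.snd_add, Pi.add_apply, fourier_add,
    Finset.prod_mul_distrib]
  ring

lemma char_neg (p : Idx) (z : Phase) : char (-p) z = conj (char p z) := by
  simp only [char_apply, Prod.fst_neg, Prod.snd_neg, Pi.neg_apply, fourier_neg, map_mul, map_prod]

/-- For `n ≠ 0`, translation by half a wavelength changes the sign of the character but not the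
integral. -/
lemma integral_fourier (n : ℤ) :
    ∫ x : T, (fourier n x : ℂ) = if n = 0 then (2 * Real.pi : ℂ) else 0 := by
  split_ifs with h
  · subst h
    simp [Real.pi_pos.le, measureReal_def]
  · have h1 := integral_add_right_eq_self (μ := (volume : Measure T)) (fun x => (fourier n x : ℂ))
      (((2 * Real.pi) / 2 / n : ℝ) : T)
    simp only [fourier_add_half_inv_index h Real.two_pi_pos, integral_neg] at h1
    exact CharZero.neg_eq_self_iff.1 h1

lemma integral_char (p : Idx) :
    ∫ z, char p z = if p = 0 then ((2 * Real.pi) ^ 3 : ℂ) else 0 := by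
  have h1 : ∫ z, char p z
      = (∫ x : Fin 2 → T, ∏ i, (fourier (p.1 i) (x i) : ℂ)) * ∫ w : T, (fourier p.2 w : ℂ) :=
    integral_prod_mul (fun x : Fin 2 → T => ∏ i, (fourier (p.1 i) (x i) : ℂ))
      (fun w : T => (fourier p.2 w : ℂ))
  rw [h1, integral_fintype_prod_volume_eq_prod (fun i (x : T) => (fourier (p.1 i) x : ℂ))]
  simp only [integral_fourier, Fin.prod_univ_two]
  by_cases h : p = 0
  · subst h; simp; ring
  · rw [if_neg h]
    have h2 : ¬(p.1 0 = 0 ∧ p.1 1 = 0 ∧ p.2 = 0) := fun ⟨a, b, c⟩ => h <| by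
      refine Prod.ext (funext fun i => ?_) c
      fin_cases i <;> assumption
    by_cases ha : p.1 0 = 0 <;> by_cases hb : p.1 1 = 0 <;> by_cases hc : p.2 = 0 <;> simp_all

/-- The normalization of the characters in `H`. -/
def nrm : ℝ := (√((2 * Real.pi) ^ 3))⁻¹

lemma nrm_pos : 0 < nrm := by unfold nrm; have := Real.pi_pos; positivity

lemma nrm_sq : nrm ^ 2 * (2 * Real.pi) ^ 3 = 1 := by
  have := Real.pi_pos
  unfold nrm
  rw [inv_pow, Real.sq_sqrt (by positivity), inv_mul_cancel₀ (by positivity)]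

/-- The normalized characters. -/
def basisFun (p : Idx) : H := (nrm : ℂ) • contLp (char p) (char p).continuous

lemma inner_basisFun (p : Idx) (f : H) :
    inner ℂ (basisFun p) f = nrm * ∫ z, f z * char (-p) z := by
  rw [basisFun, inner_smul_left, Complex.conj_ofReal, inner_contLp]
  simp only [char_neg]

lemma orthonormal_basisFun : Orthonormal ℂ basisFun := by
  rw [orthonormal_iff_ite]
  intro p q
  have h1 : ∫ z, basisFun q z * char (-p) z = nrm * ∫ z, char (q - p) z := by
    rw [← integral_const_mul]
    refine integral_congr_ae ?_
    filter_upwards [Lp.coeFn_smul (nrm : ℂ) (contLp (char q) (char q).continuous),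
      coeFn_contLp (char q).continuous] with z h2 h3
    change (((nrm : ℂ) • contLp (char q) (char q).continuous : H) z) * _ = _
    rw [h2, Pi.smul_apply, h3, sub_eq_add_neg, char_add, smul_eq_mul, mul_assoc]
  rw [inner_basisFun, h1, integral_char]
  by_cases h : p = q
  · subst h
    have := nrm_sq
    rw [sub_self, if_pos rfl, if_pos rfl]
    rw [← mul_assoc, ← sq]
    exact_mod_cast this
  · rw [if_neg h, if_neg (sub_ne_zero.2 (Ne.symm h)), mul_zero, mul_zero]

/-- The star subalgebra generated by the characters. -/
def charAlgebra : StarSubalgebra ℂ C(Phase, ℂ) where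
  toSubalgebra := Algebra.adjoin ℂ (Set.range char)
  star_mem' := by
    change Algebra.adjoin ℂ (Set.range char) ≤ star (Algebra.adjoin ℂ (Set.range char))
    refine Algebra.adjoin_le ?_
    rintro _ ⟨p, rfl⟩
    refine Algebra.subset_adjoin ⟨-p, ?_⟩
    ext1 z
    simp only [char_neg, starRingEnd_apply, ContinuousMap.star_apply]

lemma charAlgebra_coe :
    charAlgebra.toSubalgebra.toSubmodule = Submodule.span ℂ (Set.range char) := by
  apply Algebra.adjoin_eq_span_of_subset
  refine .trans (fun x ↦ Submonoid.closure_induction (fun _ ↦ id) ⟨0, ?_⟩ ?_) Submodule.subset_span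
  · ext z
    exact char_zero z
  · rintro _ _ _ _ ⟨m, rfl⟩ ⟨n, rfl⟩
    refine ⟨m + n, ?_⟩
    ext z
    exact char_add m n z

lemma charAlgebra_separatesPoints : charAlgebra.toSubalgebra.SeparatesPoints := by
  have hinj : ∀ a b : T, fourier 1 a = fourier 1 b → a = b := fun a b h => by
    rw [fourier_one, fourier_one] at h
    exact AddCircle.injective_toCircle (Real.two_pi_pos.ne') (Subtype.ext h)
  intro a b hab
  by_cases h2 : a.2 = b.2
  · have h1 : a.1 ≠ b.1 := fun h1 => hab (Prod.ext h1 h2)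
    obtain ⟨i, hi⟩ := Function.ne_iff.1 h1
    refine ⟨_, ⟨char (Pi.single i 1, 0), Algebra.subset_adjoin ⟨_, rfl⟩, rfl⟩, fun h => hi ?_⟩
    refine hinj _ _ ?_
    have h3 : ∀ z : Phase, char (Pi.single i 1, 0) z = fourier 1 (z.1 i) := fun z => by
      rw [char_apply, fourier_zero, mul_one, Finset.prod_eq_single i]
      · simp
      · intro j _ hj
        simp [hj]
      · simp
    simpa [h3] using h
  · refine ⟨_, ⟨char (0, 1), Algebra.subset_adjoin ⟨_, rfl⟩, rfl⟩, fun h => h2 ?_⟩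
    refine hinj _ _ ?_
    simpa [char_apply] using h

lemma span_char_closure_eq_top :
    (Submodule.span ℂ (Set.range char)).topologicalClosure = ⊤ := by
  rw [← charAlgebra_coe]
  exact congr_arg (Subalgebra.toSubmodule <| StarSubalgebra.toSubalgebra ·)
    (ContinuousMap.starSubalgebra_topologicalClosure_eq_top_of_separatesPoints _
      charAlgebra_separatesPoints)

/-- By Stone–Weierstrass the characters span a dense subspace of the continuous functions, and these
are dense in `H`. -/
lemma span_basisFun_orthogonal : (Submodule.span ℂ (Set.range basisFun))ᗮ = ⊥ := by
  rw [Submodule.eq_bot_iff]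
  intro g hg
  rw [Submodule.mem_orthogonal] at hg
  let L : C(Phase, ℂ) →L[ℂ] H := ContinuousMap.toLp 2 volume ℂ
  have hchar : ∀ p, inner ℂ (L (char p)) g = 0 := fun p => by
    have h := hg (basisFun p) (Submodule.subset_span ⟨p, rfl⟩)
    rw [basisFun, inner_smul_left, mul_eq_zero] at h
    exact h.resolve_left (by simpa using nrm_pos.ne')
  have hzero : ∀ ψ : C(Phase, ℂ), inner ℂ (L ψ) g = 0 := by
    have hcl : IsClosed {ψ : C(Phase, ℂ) | inner ℂ (L ψ) g = 0} :=
      isClosed_eq (by fun_prop) continuous_const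
    have hsub : (Submodule.span ℂ (Set.range char) : Set C(Phase, ℂ))
        ⊆ {ψ | inner ℂ (L ψ) g = 0} := fun ψ hψ => by
      refine Submodule.span_induction (p := fun ψ _ => inner ℂ (L ψ) g = 0) ?_ ?_ ?_ ?_ hψ
      · rintro _ ⟨p, rfl⟩; exact hchar p
      · rw [map_zero, inner_zero_left]
      · intro x y _ _ hx hy; rw [map_add, inner_add_left, hx, hy, add_zero]
      · intro c x _ hx; rw [map_smul, inner_smul_left, hx, mul_zero]
    intro ψ
    refine closure_minimal hsub hcl ?_
    rw [← Submodule.topologicalClosure_coe, span_char_closure_eq_top]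
    trivial
  have hd : DenseRange L := ContinuousMap.toLp_denseRange ℂ volume ℂ (by norm_num)
  exact inner_self_eq_zero.1 (hd.induction_on (p := fun f : H => inner ℂ f g = 0) g
    (isClosed_eq (by fun_prop) continuous_const) hzero)

/-- The Fourier basis of `H`. -/
def basis : HilbertBasis Idx ℂ H :=
  HilbertBasis.mkOfOrthogonalEqBot orthonormal_basisFun span_basisFun_orthogonal

lemma coe_basis : ⇑basis = basisFun := HilbertBasis.coe_mkOfOrthogonalEqBot _ _

lemma dense_span_basisFun : Dense (Submodule.span ℂ (Set.range basisFun) : Set H) := by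
  rw [Submodule.dense_iff_topologicalClosure_eq_top, ← coe_basis]
  exact basis.dense_span

/-- The decomposition of a function on phase space into spatial Fourier modes. -/
def modes : H ≃ₗᵢ[ℂ] lp (fun _ : Fin 2 → ℤ => Seq) 2 := basis.repr.trans lpCurry

lemma modes_apply_eq_inner (f : H) (n : Fin 2 → ℤ) (k : ℤ) :
    modes f n k = inner ℂ (basisFun (n, k)) f := by
  rw [← coe_basis, ← basis.repr_apply_apply]; rfl

lemma modes_apply (f : H) (n : Fin 2 → ℤ) (k : ℤ) :
    modes f n k = nrm * ∫ z, f z * char (-(n, k)) z := by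
  rw [modes_apply_eq_inner, inner_basisFun]

/-! ### The operators in Fourier variables -/

/-- The symbol of `n · v`: one has `n · v = z e^{iφ} + z̄ e^{-iφ}` with `z = freq n`. -/
def freq (n : Fin 2 → ℤ) : ℂ := ((n 0 : ℂ) - Complex.I * n 1) / 2

lemma norm_freq_sq (n : Fin 2 → ℤ) : ‖freq n‖ ^ 2 = ((n 0 : ℝ) ^ 2 + (n 1 : ℝ) ^ 2) / 4 := by
  rw [← Complex.normSq_eq_norm_sq, freq, Complex.normSq_div]
  simp [Complex.normSq_apply]
  ring

lemma freq_zero : freq 0 = 0 := by simp [freq]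

lemma freq_neg (n : Fin 2 → ℤ) : freq (-n) = -freq n := by simp [freq]; ring

lemma norm_freq_sq_ge {n : Fin 2 → ℤ} (hn : n ≠ 0) : 1 / 4 ≤ ‖freq n‖ ^ 2 := by
  rw [norm_freq_sq]
  have h : 1 ≤ n 0 ^ 2 + n 1 ^ 2 := by
    by_contra! hlt
    refine hn (funext fun i => ?_)
    have h0 : n 0 = 0 := by nlinarith [sq_nonneg (n 0), sq_nonneg (n 1)]
    have h1 : n 1 = 0 := by nlinarith [sq_nonneg (n 0), sq_nonneg (n 1)]
    fin_cases i <;> assumption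
  have h' : (1 : ℝ) ≤ (n 0 : ℝ) ^ 2 + (n 1 : ℝ) ^ 2 := by exact_mod_cast h
  linarith

lemma hasDerivAt_fourier_zero (n : ℤ) :
    HasDerivAt (fun s : ℝ => (fourier n (s : T) : ℂ)) (Complex.I * n) 0 := by
  refine (hasDerivAt_fourier (2 * Real.pi) n 0).congr_deriv ?_
  have : (Real.pi : ℂ) ≠ 0 := by exact_mod_cast Real.pi_ne_zero
  rw [show ((0 : ℝ) : T) = 0 from rfl, fourier_eval_zero]
  push_cast
  field_simp

lemma char_add_single (p : Idx) (i : Fin 2) (z : Phase) (a : T) :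
    char p (z.1 + Pi.single i a, z.2) = char p z * fourier (p.1 i) a := by
  have h : ∏ j, (fourier (p.1 j) ((z.1 + Pi.single i a : Fin 2 → T) j) : ℂ)
      = (∏ j, (fourier (p.1 j) (z.1 j) : ℂ))
        * ∏ j, (fourier (p.1 j) ((Pi.single i a : Fin 2 → T) j) : ℂ) := by
    rw [← Finset.prod_mul_distrib]
    refine Finset.prod_congr rfl fun j _ => ?_
    simp only [Pi.add_apply, fourier_apply, smul_add, AddCircle.toCircle_add, Circle.coe_mul]
  have h1 : ∏ j, (fourier (p.1 j) ((Pi.single i a : Fin 2 → T) j) : ℂ) = fourier (p.1 i) a := by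
    rw [Finset.prod_eq_single i]
    · simp
    · intro j _ hj
      simp [hj]
    · simp
  simp only [char_apply]
  rw [h, h1]
  ring

lemma dx_char (p : Idx) (i : Fin 2) : dx i (char p) = fun z => Complex.I * p.1 i * char p z := by
  funext z
  unfold dx
  simp only [char_add_single]
  rw [((hasDerivAt_fourier_zero (p.1 i)).const_mul (char p z)).deriv]
  ring

lemma contDiff_fourier_coe (n : ℤ) : ContDiff ℝ ∞ (fun s : ℝ => (fourier n (s : T) : ℂ)) := by
  simp only [fourier_coe_apply]
  exact ((contDiff_const.mul Complex.ofRealCLM.contDiff).div_const _).cexp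

lemma isTest_char (p : Idx) : IsTest (char p) := by
  have h : (char p ∘ cover) = fun y : (Fin 2 → ℝ) × ℝ =>
      (∏ i, (fourier (p.1 i) (y.1 i : T) : ℂ)) * fourier p.2 (y.2 : T) := rfl
  unfold IsTest
  rw [h]
  refine ContDiff.mul (contDiff_prod fun i _ => ?_) ((contDiff_fourier_coe _).comp contDiff_snd)
  exact (contDiff_fourier_coe _).comp (f := fun y : (Fin 2 → ℝ) × ℝ => y.1 i) (by fun_prop)

lemma freq_mul_fourier (n : Fin 2 → ℤ) (w : T) :
    (n 0 : ℂ) * vel 0 w + n 1 * vel 1 w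
      = freq n * fourier 1 w + conj (freq n) * fourier (-1) w := by
  obtain ⟨s, rfl⟩ := QuotientAddGroup.mk_surjective w
  rw [vel_coe_zero, vel_coe_one, Complex.ofReal_cos, Complex.ofReal_sin, Complex.cos, Complex.sin]
  have hpi : (Real.pi : ℂ) ≠ 0 := by exact_mod_cast Real.pi_ne_zero
  have h1 : (fourier 1 (s : T) : ℂ) = Complex.exp (s * Complex.I) := by
    rw [fourier_coe_apply]; congr 1; push_cast; field_simp
  have h2 : (fourier (-1) (s : T) : ℂ) = Complex.exp (-s * Complex.I) := by
    rw [fourier_coe_apply]; congr 1; push_cast; field_simp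
  rw [h1, h2, freq]
  simp only [map_div₀, map_sub, map_mul, Complex.conj_I, map_intCast, map_ofNat]
  ring

lemma vgrad_char (n : Fin 2 → ℤ) (k : ℤ) (z : Phase) :
    vgrad (char (n, k)) z
      = Complex.I * (freq n * char (n, k + 1) z + conj (freq n) * char (n, k - 1) z) := by
  have h1 : char (n, k + 1) z = char (n, k) z * fourier 1 z.2 := by
    rw [char_apply, char_apply, fourier_add, mul_assoc]
  have h2 : char (n, k - 1) z = char (n, k) z * fourier (-1) z.2 := by
    rw [char_apply, char_apply, sub_eq_add_neg, fourier_add, mul_assoc]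
  have h3 := freq_mul_fourier n z.2
  rw [h1, h2]
  simp only [vgrad, dx_char, Fin.sum_univ_two]
  linear_combination Complex.I * char (n, k) z * h3

/-- The characters are themselves admissible test functions, and `v·∇ₓ` maps each to a combination
of its two neighbours in `k`. -/
lemma modes_of_isWeakVGrad {f g : H} (h : IsWeakVGrad f g) (n : Fin 2 → ℤ) :
    modes g n = Complex.I • trans (freq n) (modes f n) := by
  refine lp.ext (funext fun k => ?_)
  change modes g n k = Complex.I * trans (freq n) (modes f n) k
  rw [trans_apply, modes_apply, modes_apply, modes_apply]
  have h1 := h (char (-(n, k))) (isTest_char _)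
  have h2 : ∫ z, f z * vgrad (char (-(n, k))) z
      = Complex.I * (-freq n * (∫ z, f z * char (-(n, k - 1)) z)
        + conj (-freq n) * ∫ z, f z * char (-(n, k + 1)) z) := by
    rw [← integral_const_mul, ← integral_const_mul, ← integral_add
      ((integrable_mul f (char _).continuous).const_mul _)
      ((integrable_mul f (char _).continuous).const_mul _), ← integral_const_mul]
    refine integral_congr_ae (ae_of_all _ fun z => ?_)
    have e1 : (-(n, k) : Idx) = (-n, -k) := rfl
    have e2 : (-(n, k - 1) : Idx) = (-n, -k + 1) := Prod.ext rfl (by simp; ring)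
    have e3 : (-(n, k + 1) : Idx) = (-n, -k - 1) := Prod.ext rfl (by simp; ring)
    simp only [e1, e2, e3, vgrad_char, freq_neg]
    ring
  rw [h2] at h1
  rw [map_neg] at h1
  linear_combination (nrm : ℂ) * h1

/-- By Parseval the weak formulation becomes symmetry of `trans` on each mode. The conjugate test
function appears because the inner product is conjugate-linear in its first argument. -/
lemma isWeakVGrad_of_modes {f g : H}
    (h : ∀ n, modes g n = Complex.I • trans (freq n) (modes f n)) : IsWeakVGrad f g := by
  intro ψ hψ
  set Ψ := contLp _ hψ.conj.continuous with hΨ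
  set Ψ' := contLp _ hψ.conj.vgrad.continuous with hΨ'
  have hm := modes_of_isWeakVGrad (isWeakVGrad_contLp hψ.conj)
  rw [← hΨ, ← hΨ'] at hm
  have e1 : ∫ z, f z * vgrad ψ z = inner ℂ Ψ' f := by
    rw [hΨ', inner_contLp]
    simp only [vgrad_conj hψ, Complex.conj_conj]
  have e2 : ∫ z, g z * ψ z = inner ℂ Ψ g := by
    rw [hΨ, inner_contLp]
    simp only [Complex.conj_conj]
  rw [e1, e2, ← modes.inner_map_map, ← modes.inner_map_map Ψ, lp.inner_eq_tsum, lp.inner_eq_tsum,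
    ← tsum_neg]
  refine tsum_congr fun n => ?_
  rw [hm, h, inner_smul_left, inner_smul_right, inner_trans, Complex.conj_I, neg_mul]

lemma isWeakVGrad_iff (f g : H) :
    IsWeakVGrad f g ↔ ∀ n, modes g n = Complex.I • trans (freq n) (modes f n) :=
  ⟨modes_of_isWeakVGrad, isWeakVGrad_of_modes⟩

lemma modes_of_isWeakSecond {i j : Fin 2} {f g : H} (h : IsWeakSecond i j f g) (n : Fin 2 → ℤ) :
    modes g n = (-(n i * n j : ℂ)) • modes f n := by
  refine lp.ext (funext fun k => ?_)
  change modes g n k = -(n i * n j : ℂ) * modes f n k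
  rw [modes_apply, modes_apply]
  have h1 := h (char (-(n, k))) (isTest_char _)
  have h2 : ∫ z, f z * dx i (dx j (char (-(n, k)))) z
      = -(n i * n j : ℂ) * ∫ z, f z * char (-(n, k)) z := by
    rw [← integral_const_mul]
    refine integral_congr_ae (ae_of_all _ fun z => ?_)
    have h3 : dx i (dx j (char (-(n, k)))) z
        = Complex.I * (-(n, k) : Idx).1 j * dx i (char (-(n, k))) z := by
      have h4 := (((isTest_char (-(n, k))).hasDerivAt_zero i z).const_mul
        (Complex.I * (-(n, k) : Idx).1 j)).deriv
      rw [dx_char (-(n, k)) j]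
      exact h4
    simp only [h3]
    simp only [dx_char, Prod.fst_neg, Pi.neg_apply, Int.cast_neg]
    linear_combination (f z * n j * n i * char (-(n, k)) z) * Complex.I_sq
  rw [← h1, h2]
  ring

lemma integral_mul_dx {ψ χ : Phase → ℂ} (hψ : IsTest ψ) (hχ : IsTest χ) (i : Fin 2) :
    ∫ z, ψ z * dx i χ z = -∫ z, dx i ψ z * χ z := by
  have h := integral_dx (hψ.mul hχ) i
  simp only [dx_mul hψ hχ] at h
  rw [integral_add (f := fun z => dx i ψ z * χ z) (g := fun z => ψ z * dx i χ z)
    (integrable_of_continuous ((hψ.dx i).continuous.mul hχ.continuous))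
    (integrable_of_continuous (hψ.continuous.mul (hχ.dx i).continuous))] at h
  rw [eq_neg_iff_add_eq_zero, add_comm, h]

lemma coeFn_smul_contLp (c : ℂ) {ψ : Phase → ℂ} (h : Continuous ψ) :
    (c • contLp ψ h : H) =ᵐ[volume] fun z => c * ψ z := by
  filter_upwards [Lp.coeFn_smul c (contLp ψ h), coeFn_contLp h] with z h2 h3
  rw [h2, Pi.smul_apply, h3, smul_eq_mul]

lemma basisFun_mem_secondOrder (p : Idx) : basisFun p ∈ secondOrder := by
  intro i j
  have hp := isTest_char p
  refine ⟨(nrm : ℂ) • contLp _ ((hp.dx i).dx j).continuous, fun ψ hψ => ?_⟩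
  have h1 : ∫ z, basisFun p z * dx i (dx j ψ) z = nrm * ∫ z, char p z * dx i (dx j ψ) z := by
    rw [← integral_const_mul]
    refine integral_congr_ae ?_
    filter_upwards [coeFn_smul_contLp nrm (char p).continuous] with z hz
    rw [basisFun, hz, mul_assoc]
  rw [h1, integral_mul_dx hp (hψ.dx j), integral_mul_dx (hp.dx i) hψ, neg_neg,
    ← integral_const_mul]
  refine integral_congr_ae ?_
  filter_upwards [coeFn_smul_contLp nrm ((hp.dx i).dx j).continuous] with z hz
  rw [hz, mul_assoc]

lemma modes_basisFun (p : Idx) (n : Fin 2 → ℤ) (k : ℤ) :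
    modes (basisFun p) n k = if p = (n, k) then 1 else 0 := by
  rw [modes_apply_eq_inner, orthonormal_iff_ite.1 orthonormal_basisFun]
  simp only [eq_comm]

lemma velMean_basisFun (p : Idx) : velMean (basisFun p) = if p.2 = 0 then basisFun p else 0 := by
  have h1 : velMean (contLp (char p) (char p).continuous)
      = if p.2 = 0 then contLp (char p) (char p).continuous else 0 := by
    have h2 := (coeFn_velMean (contLp (char p) (char p).continuous)).trans
      (velMeanFun_congr (coeFn_contLp (char p).continuous))
    have h3 : ∀ z, velMeanFun (char p) z = if p.2 = 0 then char p z else 0 := fun z => by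
      simp only [velMeanFun, average_eq, char_apply, integral_const_mul, integral_fourier]
      split_ifs with h
      · have hpi : (Real.pi : ℂ) ≠ 0 := by exact_mod_cast Real.pi_ne_zero
        simp [h, measureReal_def, Real.pi_pos.le]
        field_simp
      · simp
    refine Lp.ext (h2.trans ?_)
    split_ifs with h
    · filter_upwards [coeFn_contLp (char p).continuous] with z hz
      rw [hz, h3, if_pos h]
    · filter_upwards [Lp.coeFn_zero ℂ 2 (volume : Measure Phase)] with z hz
      rw [hz, h3, if_neg h]; rfl
  rw [basisFun, map_smul, h1]
  split_ifs <;> simp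

/-- Both sides are continuous and linear in `f`, so it is enough to compare them on characters. -/
lemma modes_velMean (f : H) (n : Fin 2 → ℤ) : modes (velMean f) n = meanPart (modes f n) := by
  refine lp.ext (funext fun k => ?_)
  let E : (Fin 2 → ℤ) → ℤ → H →L[ℂ] ℂ := fun n k => innerSL ℂ (basisFun (n, k))
  have hE : ∀ n k f, E n k f = modes f n k := fun n k f => (modes_apply_eq_inner f n k).symm
  have h : (E n k).comp velMean = if k = 0 then E n 0 else 0 := by
    refine ContinuousLinearMap.ext_on dense_span_basisFun ?_
    rintro _ ⟨p, rfl⟩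
    rw [ContinuousLinearMap.comp_apply, velMean_basisFun, hE]
    by_cases hk : k = 0 <;> by_cases hp : p.2 = 0 <;> simp only [hk, hp, if_true, if_false]
    · rw [hE]
    · rw [hE, modes_basisFun, if_neg (fun h => hp (congr_arg Prod.snd h))]; simp
    · rw [modes_basisFun, if_neg (fun h => hk ((congr_arg Prod.snd h).symm.trans hp))]; rfl
    · simp
  have h1 := congr($h f)
  rw [ContinuousLinearMap.comp_apply, hE] at h1
  rw [h1, meanPart_apply]
  split_ifs
  · rw [hE]
  · rfl

lemma modes_R (f : H) (n : Fin 2 → ℤ) : modes (R f) n = coll (modes f n) := by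
  have h : R f = f - velMean f := rfl
  rw [h, map_sub, lp.coeFn_sub, Pi.sub_apply, modes_velMean]
  rfl

lemma integral_eq_modes (f : H) : ∫ z, f z = (nrm : ℂ)⁻¹ * modes f 0 0 := by
  have h : (nrm : ℂ) ≠ 0 := by exact_mod_cast nrm_pos.ne'
  rw [modes_apply, inv_mul_cancel_left₀ h]
  refine integral_congr_ae (ae_of_all _ fun z => ?_)
  have : (-(0, 0) : Idx) = 0 := by ext <;> simp
  simp only [this, char_zero, mul_one]

lemma constFun_eq (a : ℂ) : constFun a = (a * (nrm : ℂ)⁻¹) • basisFun 0 := by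
  have h : (nrm : ℂ) ≠ 0 := by exact_mod_cast nrm_pos.ne'
  rw [basisFun, smul_smul, inv_mul_cancel_right₀ h]
  refine Lp.ext ?_
  filter_upwards [Lp.coeFn_const (p := 2) (μ := (volume : Measure Phase)) a,
    Lp.coeFn_smul a (contLp (char 0) (char 0).continuous),
    coeFn_contLp (char 0).continuous] with z h1 h2 h3
  rw [h2, Pi.smul_apply, h3, char_zero, smul_eq_mul, mul_one]
  exact h1

lemma modes_equil (f : H) (n : Fin 2 → ℤ) (k : ℤ) :
    modes (equil f) n k = if n = 0 ∧ k = 0 then modes f 0 0 else 0 := by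
  have h : (nrm : ℂ) ≠ 0 := by exact_mod_cast nrm_pos.ne'
  have h2 : (nrm : ℂ) ^ 2 * (2 * Real.pi) ^ 3 = 1 := by exact_mod_cast nrm_sq
  have hpi : (Real.pi : ℂ) ≠ 0 := by exact_mod_cast Real.pi_ne_zero
  rw [equil, constFun_eq, map_smul, integral_eq_modes]
  change _ * modes (basisFun 0) n k = _
  rw [modes_basisFun]
  by_cases hnk : n = 0 ∧ k = 0
  · rw [if_pos hnk, if_pos (by rw [hnk.1, hnk.2]; rfl)]
    push_cast
    field_simp
    linear_combination (-modes f 0 0) * h2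
  · rw [if_neg hnk, if_neg, mul_zero]
    intro h3
    exact hnk ⟨(congr_arg Prod.fst h3).symm, (congr_arg Prod.snd h3).symm⟩

lemma projConst_eq_equil (f : H) : projConst f = equil f := by
  have hspan : Submodule.span ℂ {constFun 1} = Submodule.span ℂ {basisFun 0} := by
    rw [constFun_eq]
    refine Submodule.span_singleton_smul_eq ?_ _
    simpa using nrm_pos.ne'
  have h1 : projConst f = inner ℂ (basisFun 0) f • basisFun 0 := by
    unfold projConst
    simp only [hspan]
    exact Submodule.starProjection_unit_singleton ℂ (orthonormal_basisFun.1 0) f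
  have h2 : inner ℂ (basisFun 0) f = modes f 0 0 := (modes_apply_eq_inner f 0 0).symm
  rw [h1, h2]
  refine modes.injective (lp.ext (funext fun n => lp.ext (funext fun k => ?_)))
  rw [modes_equil, map_smul]
  change _ * modes (basisFun 0) n k = _
  rw [modes_basisFun]
  by_cases hnk : n = 0 ∧ k = 0
  · rw [if_pos hnk, if_pos (by rw [hnk.1, hnk.2]; rfl), mul_one]
  · rw [if_neg hnk, if_neg, mul_zero]
    intro h3
    exact hnk ⟨(congr_arg Prod.fst h3).symm, (congr_arg Prod.snd h3).symm⟩

/-! ### Graphs of the operators -/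

lemma mem_graph_neg {A : H →ₗ.[ℂ] H} {f g : H} : (f, g) ∈ (-A).graph ↔ (f, -g) ∈ A.graph := by
  simp only [LinearPMap.mem_graph_iff]
  constructor
  · rintro ⟨y, hy, hg⟩
    refine ⟨y, hy, ?_⟩
    rw [LinearPMap.neg_apply] at hg
    exact neg_eq_iff_eq_neg.1 hg
  · rintro ⟨y, hy, hg⟩
    refine ⟨y, hy, ?_⟩
    rw [LinearPMap.neg_apply]
    exact neg_eq_iff_eq_neg.2 hg

lemma mem_J_graph {f g : H} :
    (f, g) ∈ J.graph ↔ ∀ n, modes g n = -(Complex.I • trans (freq n) (modes f n)) := by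
  rw [J, mem_graph_neg, mem_stream_graph, isWeakVGrad_iff]
  refine forall_congr' fun n => ?_
  rw [map_neg, lp.coeFn_neg, Pi.neg_apply, neg_eq_iff_eq_neg]

lemma mem_C_graph {f g : H} : (f, g) ∈ C.graph ↔ (f, R f - g) ∈ J.graph := by
  simp only [LinearPMap.mem_graph_iff]
  constructor
  · rintro ⟨y, hy, hg⟩
    refine ⟨⟨y, y.2.2⟩, hy, ?_⟩
    change R (y : H) - J ⟨y, y.2.2⟩ = g at hg
    change (y : H) = f at hy
    change J ⟨y, y.2.2⟩ = R f - g
    rw [← hg, ← hy, sub_sub_cancel]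
  · rintro ⟨y, hy, hg⟩
    refine ⟨⟨y, trivial, y.2⟩, hy, ?_⟩
    change (y : H) = f at hy
    change J y = R f - g at hg
    change R (y : H) - J y = g
    rw [hg, hy, sub_sub_cancel]

lemma mem_neg_C_graph {f g : H} :
    (f, g) ∈ (-C).graph ↔ ∀ n, modes g n = modeGen (freq n) (modes f n) := by
  rw [mem_graph_neg, mem_C_graph, mem_J_graph]
  refine forall_congr' fun n => ?_
  rw [sub_neg_eq_add, map_add, lp.coeFn_add, Pi.add_apply, modes_R, modeGen_apply, neg_add,
    ← sub_eq_neg_add, eq_sub_iff_add_eq, add_comm]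

lemma basisFun_mem_J_domain (p : Idx) : basisFun p ∈ J.domain :=
  J.domain.smul_mem _ (LinearPMap.mem_domain_iff.2
    ⟨_, (mem_stream_graph _ _).2 (isWeakVGrad_contLp (isTest_char p))⟩ : _ ∈ stream.domain)

lemma dense_J_domain : Dense (J.domain : Set H) := by
  refine dense_span_basisFun.mono (Submodule.span_le.2 ?_)
  rintro _ ⟨p, rfl⟩
  exact basisFun_mem_J_domain p

/-- Only the inclusion of `-J` in its adjoint is needed. Density of the domain matters because
`LinearPMap.adjoint` takes a default value without it. -/
lemma J_adjoint_apply {f g : H} (h : ∀ n, modes g n = Complex.I • trans (freq n) (modes f n)) :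
    ∃ hf : f ∈ J.adjoint.domain, J.adjoint ⟨f, hf⟩ = g := by
  have hadj : ∀ x : J.domain, inner ℂ g (x : H) = inner ℂ f (J x) := fun x => by
    have hx := mem_J_graph.1 (LinearPMap.mem_graph J x)
    rw [← modes.inner_map_map, ← modes.inner_map_map f, lp.inner_eq_tsum, lp.inner_eq_tsum]
    refine tsum_congr fun n => ?_
    rw [h, hx, inner_smul_left, inner_neg_right, inner_smul_right, inner_trans, Complex.conj_I,
      neg_mul]
  exact ⟨LinearPMap.mem_adjoint_domain_of_exists f ⟨g, hadj⟩,
    LinearPMap.adjoint_apply_eq dense_J_domain _ hadj⟩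

lemma exists_modes_of_le {v : (Fin 2 → ℤ) → Seq} {s : H} (h : ∀ n, ‖v n‖ ≤ ‖modes s n‖) :
    ∃ g : H, ∀ n, modes g n = v n := by
  have hv : Memℓp v 2 := memℓp_two_iff.2 <|
    (hasSum_norm_sq (modes s)).summable.of_nonneg_of_le (fun _ => by positivity) fun n =>
      pow_le_pow_left₀ (norm_nonneg _) (h n) 2
  refine ⟨modes.symm ⟨v, hv⟩, fun n => ?_⟩
  rw [modes.apply_symm_apply]

lemma hasSum_re_inner (f g : H) :
    HasSum (fun n => (inner ℂ (modes f n) (modes g n)).re) (inner ℂ f g).re := by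
  rw [← modes.inner_map_map]
  exact Complex.reCLM.hasSum (lp.hasSum_inner (𝕜 := ℂ) (modes f) (modes g))

lemma hasSum_norm_modes_sq (f : H) : HasSum (fun n => ‖modes f n‖ ^ 2) (‖f‖ ^ 2) := by
  rw [← modes.norm_map f]
  exact hasSum_norm_sq (modes f)

lemma modes_zero_of_mem_meanZero {f : H} (hf : f ∈ meanZero) : modes f 0 0 = 0 := by
  have h : ∫ z, f z = 0 := hf
  rw [integral_eq_modes, mul_eq_zero] at h
  exact h.resolve_left (by simpa using nrm_pos.ne')

/-! ### Coercivity -/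

/-- The Laplacian dominates, mode by mode, every function met in forming `J* f` and `J R J* f`; this
is how second derivatives put `f` in the domain. -/
lemma exists_laplacian {f : H} (hf : f ∈ secondOrder) :
    ∃ s : H, ∀ n, ‖modes s n‖ = 4 * ‖freq n‖ ^ 2 * ‖modes f n‖ := by
  obtain ⟨g₀, h₀⟩ := hf 0 0
  obtain ⟨g₁, h₁⟩ := hf 1 1
  refine ⟨g₀ + g₁, fun n => ?_⟩
  rw [map_add, lp.coeFn_add, Pi.add_apply, modes_of_isWeakSecond h₀, modes_of_isWeakSecond h₁,
    ← add_smul, norm_smul, norm_freq_sq]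
  congr 1
  have h : (-(n 0 * n 0 : ℂ) + -(n 1 * n 1 : ℂ))
      = ((-((n 0 : ℝ) ^ 2 + (n 1 : ℝ) ^ 2) : ℝ) : ℂ) := by
    push_cast; ring
  rw [h, Complex.norm_real, norm_neg, Real.norm_of_nonneg (by positivity)]
  ring

lemma norm_freq_le (n : Fin 2 → ℤ) : 2 * ‖freq n‖ ≤ 4 * ‖freq n‖ ^ 2 := by
  by_cases hn : n = 0
  · subst hn; simp [freq_zero]
  · have h := norm_freq_sq_ge hn
    have h2 : 1 / 2 ≤ ‖freq n‖ := by
      by_contra! hlt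
      nlinarith [norm_nonneg (freq n)]
    nlinarith

lemma coercive_modes {f : H} (hf : f ∈ meanZero) (n : Fin 2 → ℤ) :
    (3 - √5) / 2 * ‖modes f n‖ ^ 2
      ≤ ‖coll (modes f n)‖ ^ 2 + ‖coll (trans (freq n) (modes f n))‖ ^ 2 := by
  by_cases hn : n = 0
  · subst hn
    have h5 : 2 < √5 := by
      rw [Real.lt_sqrt (by norm_num)]; norm_num
    rw [norm_coll_sq, modes_zero_of_mem_meanZero hf, norm_zero]
    nlinarith [sq_nonneg ‖modes f 0‖, sq_nonneg ‖coll (trans (freq 0) (modes f 0))‖]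
  · exact mode_coercive (norm_freq_sq_ge hn) _

theorem coerciveSum_one :
    CoerciveSum R J (secondOrder ∩ meanZero) 1 ((3 - √5) / 2) := by
  rintro f ⟨hf, hf0⟩
  obtain ⟨s, hs⟩ := exists_laplacian hf
  have hI : ∀ x : Seq, ‖Complex.I • x‖ = ‖x‖ := fun x => by
    rw [norm_smul, Complex.norm_I, one_mul]
  have hJ : ∀ n (x : Seq), ‖trans (freq n) x‖ ≤ 2 * ‖freq n‖ * ‖x‖ := fun n => norm_trans_le _
  -- `u` is `J* f`, and `g` below is `J R u`.
  obtain ⟨u, hu⟩ := exists_modes_of_le (s := s)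
    (v := fun n => Complex.I • trans (freq n) (modes f n)) fun n => by
      rw [hI, hs]
      exact (hJ n _).trans (mul_le_mul_of_nonneg_right (norm_freq_le n) (norm_nonneg _))
  obtain ⟨g, hg⟩ := exists_modes_of_le (s := s)
    (v := fun n => -(Complex.I • trans (freq n) (modes (R u) n))) fun n => by
      rw [norm_neg, hI, modes_R, hs]
      have h1 : ‖coll (modes u n)‖ ≤ 2 * ‖freq n‖ * ‖modes f n‖ := by
        refine (norm_coll_le _).trans ?_
        rw [hu, hI]
        exact hJ n _
      calc _ ≤ 2 * ‖freq n‖ * ‖coll (modes u n)‖ := hJ n _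
        _ ≤ 2 * ‖freq n‖ * (2 * ‖freq n‖ * ‖modes f n‖) := by gcongr
        _ = _ := by ring
  obtain ⟨hfu, hJu⟩ := J_adjoint_apply hu
  obtain ⟨y, hy, hyg⟩ := (LinearPMap.mem_graph_iff J).1 (mem_J_graph.2 hg)
  refine ⟨fun j => if j = 0 then R f else g, fun j hj => ?_, ?_⟩
  · interval_cases j
    · exact ⟨f, rfl, rfl⟩
    · refine ⟨u, ⟨hfu, hJu.symm⟩, ?_⟩
      change (y : H) = R u at hy
      refine ⟨hy ▸ y.2, ?_⟩
      change g = J ⟨R u, _⟩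
      rw [← show J y = g from hyg]
      congr 1
      exact Subtype.ext hy
  · rw [Finset.sum_range_succ, Finset.sum_range_one, if_pos rfl, if_neg one_ne_zero,
      inner_add_right, Complex.add_re]
    refine hasSum_le (fun n => ?_) ((hasSum_norm_modes_sq f).mul_left _)
      ((hasSum_re_inner f (R f)).add (hasSum_re_inner f g))
    refine (coercive_modes hf0 n).trans (le_of_eq ?_)
    -- The two factors `i` give `-1`, which cancels the sign of `J`. Moving `trans` across the inner
    -- product leaves `‖coll (trans h)‖²`.
    rw [modes_R, re_inner_coll, hg, modes_R, hu, map_smul, map_smul, smul_smul, Complex.I_mul_I,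
      neg_smul, one_smul, neg_neg, ← inner_trans, re_inner_coll]

theorem isHCIndex_one : IsHCIndex R J (secondOrder ∩ meanZero) 1 := by
  have h5 : √5 < 3 := by
    rw [Real.sqrt_lt' (by norm_num)]; norm_num
  refine ⟨⟨_, by linarith, coerciveSum_one⟩, ?_⟩
  rintro k ⟨κ, hκ, hk⟩
  by_contra! hlt
  obtain rfl : k = 0 := by omega
  -- The function `e^{i x₁}` has mean zero and does not depend on `v`, so `R` annihilates it.
  let p : Idx := (Pi.single 0 1, 0)
  have hp : p.1 ≠ 0 := fun h => by simpa [p] using congr_fun h 0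
  have hmean : basisFun p ∈ meanZero := by
    change ∫ z, basisFun p z = 0
    rw [integral_eq_modes, modes_basisFun, if_neg (fun h => hp (congr_arg Prod.fst h)), mul_zero]
  obtain ⟨g, hg, hle⟩ := hk (basisFun p) ⟨basisFun_mem_secondOrder p, hmean⟩
  obtain ⟨u, hu, hg0⟩ := hg 0 le_rfl
  have hu' : u = basisFun p := hu
  have hg0' : g 0 = R u := hg0
  have hR : R (basisFun p) = 0 := by
    change basisFun p - velMean (basisFun p) = 0
    rw [velMean_basisFun, if_pos rfl, sub_self]
  rw [zero_add, Finset.sum_range_one, hg0', hu', hR, inner_zero_right, Complex.zero_re,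
    orthonormal_basisFun.1 p] at hle
  linarith

/-! ### The semigroup -/

section Flow

variable {K : Type*} [NormedAddCommGroup K] [InnerProductSpace ℂ K] [CompleteSpace K]

lemma hasDerivAt_flow' (M : K →L[ℂ] K) (u : K) (t : ℝ) :
    HasDerivAt (fun s => flow M s u) (flow M t (M u)) t := by
  have h : HasDerivAt (fun s : ℝ => NormedSpace.exp (s • M)) (NormedSpace.exp (t • M) * M) t :=
    hasDerivAt_exp_smul_const M t
  exact ((ContinuousLinearMap.apply ℂ K u).restrictScalars ℝ).hasFDerivAt.comp_hasDerivAt t h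

/-- Writing the derivative as the flow applied to `M u` bounds the difference quotient by `‖M u‖`
and not by `‖M‖ ‖u‖`. This makes it summable over the modes although `‖modeGen (freq n)‖` is
unbounded in `n`. -/
lemma norm_flow_sub_le {M : K →L[ℂ] K} (hM : ∀ u, (inner ℂ u (M u)).re ≤ 0) (u : K) {t : ℝ}
    (ht : 0 ≤ t) : ‖flow M t u - u‖ ≤ ‖M u‖ * t := by
  have h := norm_image_sub_le_of_norm_deriv_le_segment' (f := fun s => flow M s u)
    (C := ‖M u‖) (a := 0) (b := t) (fun x _ => (hasDerivAt_flow' M u x).hasDerivWithinAt)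
    (fun x hx => norm_flow_apply_le hM (M u) hx.1) t (Set.right_mem_Icc.2 ht)
  simpa [flow_zero] using h

lemma tendsto_coe_nnreal : Tendsto ((↑) : ℝ≥0 → ℝ) (𝓝[>] 0) (𝓝[>] 0) :=
  tendsto_nhdsWithin_iff.2 ⟨(NNReal.continuous_coe.tendsto' 0 0 rfl).mono_left nhdsWithin_le_nhds,
    eventually_nhdsWithin_of_forall fun t ht => by simpa using ht⟩

lemma tendsto_flow (M : K →L[ℂ] K) (u : K) :
    Tendsto (fun t : ℝ≥0 => (t : ℝ)⁻¹ • (flow M t u - u)) (𝓝[>] 0) (𝓝 (M u)) := by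
  have h := hasDerivAt_iff_tendsto_slope_zero.1 (hasDerivAt_flow M u 0)
  simp only [zero_add, flow_zero, ContinuousLinearMap.id_apply] at h
  exact (h.mono_left (nhdsGT_le_nhdsNE 0)).comp tendsto_coe_nnreal

end Flow

/-- The propagator of the Lorentz kinetic equation. -/
def propagator (t : ℝ≥0) : H →L[ℂ] H :=
  (modes.symm : lp (fun _ : Fin 2 → ℤ => Seq) 2 →L[ℂ] H).comp
    ((diag (fun n => flow (modeGen (freq n)) t)
      fun _ => norm_flow_le (modeGen_dissipative _) t.2).comp
      (modes : H →L[ℂ] lp (fun _ : Fin 2 → ℤ => Seq) 2))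

lemma modes_propagator (t : ℝ≥0) (f : H) (n : Fin 2 → ℤ) :
    modes (propagator t f) n = flow (modeGen (freq n)) t (modes f n) := by
  change modes (modes.symm _) n = _
  rw [modes.apply_symm_apply]
  rfl

lemma modes_ext {f g : H} (h : ∀ n, modes f n = modes g n) : f = g :=
  modes.injective (lp.ext (funext h))

lemma tendsto_of_modes {α : Type*} {l : Filter α} {F : α → H} {f : H} {b : (Fin 2 → ℤ) → ℝ}
    (hb : Summable b) (hle : ∀ᶠ a in l, ∀ n, ‖modes (F a) n - modes f n‖ ^ 2 ≤ b n)
    (hF : ∀ n, Tendsto (fun a => modes (F a) n) l (𝓝 (modes f n))) : Tendsto F l (𝓝 f) := by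
  have h := tendsto_of_dominated hb hle hF
  have h1 := (modes.symm.continuous.tendsto _).comp h
  simpa [Function.comp_def] using h1

lemma continuous_modes_apply (n : Fin 2 → ℤ) : Continuous fun f => modes f n :=
  (lpEval ℂ n).continuous.comp modes.continuous

lemma isC0Semigroup_propagator : IsC0Semigroup propagator where
  zero := ContinuousLinearMap.ext fun f => modes_ext fun n => by
    rw [modes_propagator, NNReal.coe_zero, flow_zero]; rfl
  add s t := ContinuousLinearMap.ext fun f => modes_ext fun n => by
    rw [modes_propagator, NNReal.coe_add, flow_add, ContinuousLinearMap.comp_apply,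
      ContinuousLinearMap.comp_apply, modes_propagator, modes_propagator]
  continuous f := by
    rw [continuous_iff_continuousAt]
    intro t₀
    refine tendsto_of_modes ((hasSum_norm_modes_sq f).summable.mul_left 4)
      (Eventually.of_forall fun t n => ?_) fun n => ?_
    · have h : ∀ t : ℝ≥0, ‖modes (propagator t f) n‖ ≤ ‖modes f n‖ := fun t => by
        rw [modes_propagator]
        exact norm_flow_apply_le (modeGen_dissipative _) _ t.2
      have h2 : ‖modes (propagator t f) n - modes (propagator t₀ f) n‖ ≤ 2 * ‖modes f n‖ :=
        (norm_sub_le _ _).trans (by linarith [h t, h t₀])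
      refine (pow_le_pow_left₀ (norm_nonneg _) h2 2).trans (le_of_eq ?_)
      ring
    · simp only [modes_propagator]
      have hc : Continuous fun s : ℝ => flow (modeGen (freq n)) s (modes f n) :=
        continuous_iff_continuousAt.2 fun s => (hasDerivAt_flow _ _ s).continuousAt
      exact (hc.comp NNReal.continuous_coe).tendsto t₀

lemma modes_real_smul (c : ℝ) (f : H) (n : Fin 2 → ℤ) : modes (c • f) n = c • modes f n := by
  have h1 : c • f = (c : ℂ) • f := (Complex.coe_smul c f).symm
  rw [h1, map_smul]
  exact Complex.coe_smul c (modes f n)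

lemma modes_sub (f g : H) (n : Fin 2 → ℤ) : modes (f - g) n = modes f n - modes g n := by
  rw [map_sub]; rfl

theorem isGeneratedBy_propagator : IsGeneratedBy propagator (-C) := by
  refine ⟨isC0Semigroup_propagator, fun f g => ?_⟩
  rw [mem_neg_C_graph]
  have hlim : ∀ n, Tendsto (fun t : ℝ≥0 => modes ((t : ℝ)⁻¹ • (propagator t f - f)) n)
      (𝓝[>] 0) (𝓝 (modeGen (freq n) (modes f n))) := fun n => by
    simp only [modes_real_smul, modes_sub, modes_propagator]
    exact tendsto_flow _ _
  constructor
  · intro h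
    refine tendsto_of_modes ((hasSum_norm_modes_sq g).summable.mul_left 4)
      (eventually_nhdsWithin_of_forall fun t ht n => ?_) fun n => by rw [h]; exact hlim n
    have ht0 : (0 : ℝ) < t := by simpa using ht
    have h1 := norm_flow_sub_le (modeGen_dissipative (freq n)) (modes f n) ht0.le
    rw [← h] at h1
    rw [modes_real_smul, modes_sub, modes_propagator]
    have h2 : ‖(t : ℝ)⁻¹ • (flow (modeGen (freq n)) t (modes f n) - modes f n)‖ ≤ ‖modes g n‖ := by
      rw [norm_smul, norm_inv, Real.norm_of_nonneg ht0.le, inv_mul_le_iff₀ ht0]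
      exact h1.trans_eq (mul_comm _ _)
    have h3 := (norm_sub_le _ (modes g n)).trans (add_le_add_left h2 ‖modes g n‖)
    refine (pow_le_pow_left₀ (norm_nonneg _) h3 2).trans (le_of_eq ?_)
    ring
  · intro h n
    exact tendsto_nhds_unique (((continuous_modes_apply n).tendsto g).comp h) (hlim n)

lemma dense_generator_domain : Dense {f : H | ∃ g, (f, g) ∈ (-C).graph} := by
  refine dense_J_domain.mono fun f hf => ?_
  obtain ⟨g, hg⟩ := LinearPMap.mem_domain_iff.1 hf
  refine ⟨g - R f, ?_⟩
  rw [mem_graph_neg, mem_C_graph, sub_neg_eq_add, add_sub_cancel]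
  exact hg

/-- A semigroup commutes with its own difference quotients, so it preserves the domain of its
generator. -/
lemma IsGeneratedBy.mem_graph {Q : ℝ≥0 → H →L[ℂ] H} {A : H →ₗ.[ℂ] H} (hQ : IsGeneratedBy Q A)
    {f g : H} (h : (f, g) ∈ A.graph) (s : ℝ≥0) : (Q s f, Q s g) ∈ A.graph := by
  rw [hQ.2] at h ⊢
  refine (((Q s).continuous.tendsto g).comp h).congr fun t => ?_
  have h1 : Q t (Q s f) = Q s (Q t f) := by
    have e1 := congr($(hQ.1.add t s) f)
    have e2 := congr($(hQ.1.add s t) f)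
    rw [add_comm t s, e2] at e1
    exact e1.symm
  rw [Function.comp_apply, h1, ← map_sub]
  exact ((Q s).restrictScalars ℝ).map_smul _ _

theorem generated_unique {Q : ℝ≥0 → H →L[ℂ] H} (hQ : IsGeneratedBy Q (-C)) : Q = propagator := by
  funext T
  -- On the domain, each mode of an orbit of `Q` has right derivative `modeGen (freq n)` of itself.
  -- Right derivatives suffice for uniqueness of a Lipschitz ODE, and density extends the equality
  -- to all of `H`.
  have key : Set.EqOn (Q T) (propagator T) {f : H | ∃ g, (f, g) ∈ (-C).graph} := by
    rintro f ⟨g, hg⟩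
    refine modes_ext fun n => ?_
    rw [modes_propagator]
    set M := modeGen (freq n)
    set h : ℝ → Seq := fun s => modes (Q s.toNNReal f) n with hh
    have hcont : Continuous h :=
      (continuous_modes_apply n).comp ((hQ.1.continuous f).comp continuous_real_toNNReal)
    have hder : ∀ s ∈ Set.Ico (0 : ℝ) T, HasDerivWithinAt h (M (h s)) (Set.Ici s) s := by
      rintro s ⟨hs, -⟩
      have hgr := hQ.mem_graph hg s.toNNReal
      have hlim := (hQ.2 _ _).1 hgr
      rw [mem_neg_C_graph] at hgr
      have hto : Tendsto Real.toNNReal (𝓝[>] 0) (𝓝[>] 0) :=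
        tendsto_nhdsWithin_iff.2
          ⟨(continuous_real_toNNReal.tendsto' 0 0 (by simp)).mono_left nhdsWithin_le_nhds,
            eventually_nhdsWithin_of_forall fun t ht => by simpa using ht⟩
      have h2 := (((continuous_modes_apply n).tendsto _).comp hlim).comp hto
      rw [hgr n] at h2
      rw [← hasDerivWithinAt_Ioi_iff_Ici, hasDerivWithinAt_iff_tendsto_slope' (by simp)]
      have hsub : Tendsto (fun y : ℝ => y - s) (𝓝[>] s) (𝓝[>] 0) :=
        tendsto_nhdsWithin_iff.2 ⟨((continuous_id.sub continuous_const).tendsto' s 0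
          (sub_self s)).mono_left nhdsWithin_le_nhds,
          eventually_nhdsWithin_of_forall fun y hy =>
            Set.mem_Ioi.2 (sub_pos.2 (Set.mem_Ioi.1 hy))⟩
      refine (h2.comp hsub).congr' ?_
      filter_upwards [self_mem_nhdsWithin] with y hy
      have hy' : s < y := hy
      have e1 : Q (y - s).toNNReal (Q s.toNNReal f) = Q y.toNNReal f := by
        have e2 := congr($(hQ.1.add (y - s).toNNReal s.toNNReal) f)
        rw [← Real.toNNReal_add (sub_pos.2 hy').le hs, sub_add_cancel] at e2
        exact e2.symm
      simp only [Function.comp_apply, modes_real_smul, modes_sub, e1, slope, vsub_eq_sub,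
        Real.coe_toNNReal _ (sub_pos.2 hy').le, hh]
    have huniq := ODE_solution_unique_of_mem_Icc_right (v := fun _ => M) (s := fun _ => Set.univ)
      (f := h) (g := fun s => flow M s (modes f n)) (a := 0) (b := T)
      (fun _ _ => M.lipschitz.lipschitzOnWith) hcont.continuousOn hder (fun _ _ => trivial)
      (fun s _ => (hasDerivAt_flow M _ s).continuousAt.continuousWithinAt)
      (fun s _ => (hasDerivAt_flow M _ s).hasDerivWithinAt) (fun _ _ => trivial)
      (by simp [hh, hQ.1.zero, flow_zero])
    have h1 := huniq (Set.right_mem_Icc.2 T.2)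
    simpa [hh] using h1
  exact ContinuousLinearMap.ext fun f => congr_fun
    (Continuous.ext_on dense_generator_domain (Q T).continuous (propagator T).continuous key) f

/-! ### Equilibria -/

lemma modeGen_modes_equil (f : H) (n : Fin 2 → ℤ) : modeGen (freq n) (modes (equil f) n) = 0 := by
  refine lp.ext (funext fun k => ?_)
  rw [modeGen_apply_apply]
  simp only [modes_equil]
  by_cases hn : n = 0
  · subst hn
    simp only [freq_zero, map_zero, zero_mul, add_zero, mul_zero, true_and]
    split_ifs <;> simp
  · simp [hn]

lemma modes_sub_equil (f : H) (n : Fin 2 → ℤ) :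
    modes (f - equil f) n = if n = 0 then coll (modes f 0) else modes f n := by
  rw [modes_sub]
  refine lp.ext (funext fun k => ?_)
  rw [lp.coeFn_sub, Pi.sub_apply, modes_equil]
  by_cases hn : n = 0
  · subst hn
    rw [if_pos rfl, coll_apply]
    by_cases hk : k = 0
    · subst hk; simp
    · simp [hk]
  · simp [hn]

lemma norm_sub_equil_le (f : H) : ‖f - equil f‖ ≤ ‖f‖ := by
  rw [← modes.norm_map, ← modes.norm_map f, ← one_mul ‖modes f‖]
  refine norm_le_of_apply_le zero_le_one fun n => ?_
  rw [modes_sub_equil, one_mul]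
  split_ifs with hn
  · subst hn; exact norm_coll_le _
  · exact le_rfl

lemma propagator_equil (t : ℝ≥0) (f : H) : propagator t (equil f) = equil f :=
  modes_ext fun n => by
    rw [modes_propagator, ← sub_eq_zero, ← norm_le_zero_iff]
    have h := norm_flow_sub_le (modeGen_dissipative (freq n)) (modes (equil f) n) t.2
    rw [modeGen_modes_equil, norm_zero, zero_mul] at h
    exact h

lemma equil_eq_zero {f : H} (hf : modes f 0 0 = 0) : equil f = 0 :=
  modes_ext fun n => lp.ext <| funext fun k => by
    rw [modes_equil, hf, map_zero, ite_self]; rfl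

theorem equilibrium_iff (f₀ g : H) :
    ((g, 0) ∈ C.graph ∧ (∫ z, g z) = ∫ z, f₀ z) ↔ g = equil f₀ := by
  have hgraph : (g, 0) ∈ C.graph ↔ ∀ n, modeGen (freq n) (modes g n) = 0 := by
    have h := mem_neg_C_graph (f := g) (g := 0)
    rw [mem_graph_neg, neg_zero] at h
    rw [h]
    refine forall_congr' fun n => ?_
    rw [map_zero, eq_comm]; rfl
  have hnrm : (nrm : ℂ)⁻¹ ≠ 0 := by simpa using nrm_pos.ne'
  rw [hgraph, integral_eq_modes, integral_eq_modes, mul_right_inj' hnrm]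
  constructor
  · rintro ⟨h, hmass⟩
    refine modes_ext fun n => lp.ext <| funext fun k => ?_
    rw [modes_equil]
    -- The energy identity kills every coefficient with `k ≠ 0`. For `n ≠ 0` the equation at `k = 1`
    -- then reads `freq n * h 0 = 0`.
    have hcoll : coll (modes g n) = 0 := by
      have h1 := re_inner_modeGen (freq n) (modes g n)
      rw [h n, inner_zero_right, Complex.zero_re] at h1
      have h2 : ‖coll (modes g n)‖ ^ 2 = 0 := by linarith
      exact norm_eq_zero.1 (pow_eq_zero_iff two_ne_zero |>.1 h2)
    have hk : ∀ k, k ≠ 0 → modes g n k = 0 := fun k hk => by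
      have h1 := coll_apply (modes g n) k
      rw [hcoll, if_neg hk] at h1
      exact h1.symm
    by_cases hk0 : k = 0
    · subst hk0
      by_cases hn : n = 0
      · subst hn; simpa using hmass
      · have h1 := modeGen_apply_apply (freq n) (modes g n) 1
        rw [h n, hk 1 one_ne_zero, hk (1 + 1) (by norm_num)] at h1
        have hf : freq n ≠ 0 := fun h0 => by
          have := norm_freq_sq_ge hn
          rw [h0] at this; norm_num at this
        simpa [hn, hf] using h1
    · rw [hk k hk0, if_neg fun h => hk0 h.2]
  · rintro rfl
    refine ⟨modeGen_modes_equil f₀, ?_⟩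
    rw [modes_equil, if_pos ⟨rfl, rfl⟩]

/-! ### Decay of the propagator -/

/-- Numerically `rate ≈ 0.0857`. The modes decay at rate `1/10`, half of the `1/5` obtained for
squared norms, so the upper bound is what transfers their decay to `rate`. -/
lemma rate_bounds : 0 < rate ∧ rate ≤ 1 / 10 := by
  have h2a : 7 / 5 < √2 := by rw [Real.lt_sqrt (by norm_num)]; norm_num
  have h2b : √2 < 3 / 2 := by rw [Real.sqrt_lt' (by norm_num)]; norm_num
  have h8a : 14 / 5 < √8 := by rw [Real.lt_sqrt (by norm_num)]; norm_num
  have h8b : √8 < 20 / 7 := by rw [Real.sqrt_lt' (by norm_num)]; norm_num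
  have e1 : 1 / (6 * √2) ≤ 5 / 42 := by
    rw [div_le_div_iff₀ (by positivity) (by norm_num)]; linarith
  have e2 : 1 / 9 ≤ 1 / (6 * √2) := by
    rw [div_le_div_iff₀ (by norm_num) (by positivity)]; linarith
  have e3 : 1 / √8 ≤ 5 / 14 := by
    rw [div_le_div_iff₀ (by positivity) (by norm_num)]; linarith
  have e4 : 7 / 20 ≤ 1 / √8 := by
    rw [div_le_div_iff₀ (by norm_num) (by positivity)]; linarith
  have e5 : √(7 / 16 + 1 / √8) < 9 / 10 := by
    rw [Real.sqrt_lt' (by norm_num)]; linarith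
  have e6 : 22 / 25 < √(7 / 16 + 1 / √8) := by
    rw [Real.lt_sqrt (by norm_num)]; linarith
  unfold rate
  constructor <;> linarith

lemma propagator_sub_equil (t : ℝ≥0) (f : H) :
    propagator t f - equil f = propagator t (f - equil f) := by
  rw [map_sub, propagator_equil]

lemma norm_propagator_sub_equil_le (f : H) (t : ℝ≥0) :
    ‖propagator t f - equil f‖ ≤ √3 * Real.exp (-rate * t) * ‖f - equil f‖ := by
  rw [propagator_sub_equil, ← modes.norm_map, ← modes.norm_map (f - equil f)]
  refine norm_le_of_apply_le (by positivity) fun n => ?_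
  rw [modes_propagator]
  set u := modes (f - equil f) n with hu
  have ht : (0 : ℝ) ≤ t := t.2
  have hsq : ‖flow (modeGen (freq n)) t u‖ ^ 2 ≤ 3 * Real.exp (-(1 / 5) * t) * ‖u‖ ^ 2 := by
    by_cases hn : n = 0
    · subst hn
      rw [freq_zero, norm_flow_zero_le]
      · have h1 : Real.exp (-2 * (t : ℝ)) ≤ Real.exp (-(1 / 5) * t) :=
          Real.exp_le_exp.2 (by nlinarith)
        have h2 := Real.exp_pos (-(1 / 5) * (t : ℝ))
        have h3 : 0 ≤ ‖u‖ ^ 2 := by positivity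
        gcongr
        linarith
      · rw [hu, modes_sub_equil, if_pos rfl, coll_apply, if_pos rfl]
    · exact norm_flow_sq_le (norm_freq_sq_ge hn) u ht
  refine (pow_le_pow_iff_left₀ (norm_nonneg _) (by positivity) two_ne_zero).1 (hsq.trans ?_)
  rw [mul_pow, mul_pow, Real.sq_sqrt (by norm_num), ← Real.exp_nat_mul]
  have he : Real.exp (-(1 / 5) * t) ≤ Real.exp ((2 : ℕ) * (-rate * t)) := by
    have := rate_bounds.2
    refine Real.exp_le_exp.2 ?_
    push_cast
    nlinarith
  gcongr

theorem hypocoerciveOn_propagator : HypocoerciveOn propagator meanZero := by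
  refine ⟨√3, rate, rate_bounds.1, fun f hf t => ?_⟩
  have h := norm_propagator_sub_equil_le f t
  rwa [equil_eq_zero (modes_zero_of_mem_meanZero hf), sub_zero, sub_zero] at h

lemma propagator_sub_projConst_apply (t : ℝ≥0) (f : H) :
    (propagator t - projConst) f = propagator t (f - equil f) := by
  rw [← propagator_sub_equil, ← projConst_eq_equil]; rfl

lemma norm_propagator_sub_projConst_le {t : ℝ≥0} (ht : (t : ℝ) ≤ 1) :
    ‖propagator t - projConst‖ ≤ 1 - 1 / 24000 * (t : ℝ) ^ 3 := by
  have ht0 : (0 : ℝ) ≤ t := t.2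
  have ht3 : (t : ℝ) ^ 3 ≤ t := pow_le_of_le_one ht0 ht (by norm_num)
  have hc : 0 ≤ 1 - 1 / 24000 * (t : ℝ) ^ 3 := by linarith
  refine ContinuousLinearMap.opNorm_le_bound _ hc fun f => ?_
  rw [propagator_sub_projConst_apply]
  refine le_trans ?_ (mul_le_mul_of_nonneg_left (norm_sub_equil_le f) hc)
  rw [← modes.norm_map, ← modes.norm_map (f - equil f)]
  refine norm_le_of_apply_le hc fun n => ?_
  rw [modes_propagator]
  by_cases hn : n = 0
  · subst hn
    set u := modes (f - equil f) 0 with hu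
    have hu0 : u 0 = 0 := by rw [hu, modes_sub_equil, if_pos rfl, coll_apply, if_pos rfl]
    refine (pow_le_pow_iff_left₀ (norm_nonneg _) (by positivity) two_ne_zero).1 ?_
    rw [freq_zero, norm_flow_zero_le u hu0, mul_pow]
    gcongr
    -- The zero frequency decays like `e^{-t} ≤ 1 - t/2` on `[0, 1]`, far below the cubic bound.
    have h1 : Real.exp (-t) ≤ 1 - 1 / 24000 * (t : ℝ) ^ 3 := by
      have h2 : Real.exp (-t) * (1 + t) ≤ 1 := by
        have h3 := mul_le_mul_of_nonneg_left (Real.add_one_le_exp (t : ℝ)) (Real.exp_pos (-t)).le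
        rw [← Real.exp_add, neg_add_cancel, Real.exp_zero] at h3
        linarith
      have h4 : 1 ≤ (1 - 1 / 2 * (t : ℝ)) * (1 + t) := by nlinarith
      have h5 : Real.exp (-t) ≤ 1 - 1 / 2 * (t : ℝ) :=
        le_of_mul_le_mul_right (h2.trans h4) (by linarith)
      linarith
    have h6 : Real.exp (-2 * (t : ℝ)) = Real.exp (-t) ^ 2 := by
      rw [← Real.exp_nat_mul]; congr 1; push_cast; ring
    rw [h6]
    exact pow_le_pow_left₀ (Real.exp_pos _).le h1 2
  · exact norm_flow_le_short (norm_freq_sq_ge hn) _ ht0 ht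

lemma norm_propagator_sub_projConst_ge (t : ℝ≥0) (n : Fin 2 → ℤ) (hn : n ≠ 0) :
    1 - ‖modeGen (freq n)‖ ^ 2 * (t : ℝ) ^ 3 ≤ ‖propagator t - projConst‖ := by
  set b := basisFun (n, 0)
  have hb : modes b n = lp.single 2 (0 : ℤ) (1 : ℂ) := lp.ext <| funext fun k => by
    rw [modes_basisFun, lp.single_apply]
    by_cases hk : k = 0
    · subst hk; simp
    · simp [hk, Ne.symm hk]
  have heq : equil b = 0 := equil_eq_zero <| by
    rw [modes_basisFun, if_neg fun h => hn (congr_arg Prod.fst h)]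
  have h1 := (propagator t - projConst).le_opNorm b
  rw [propagator_sub_projConst_apply, heq, sub_zero, orthonormal_basisFun.1, mul_one] at h1
  refine le_trans ?_ h1
  rw [← modes.norm_map]
  refine le_trans ?_ (lp.norm_apply_le_norm (by norm_num) _ n)
  rw [modes_propagator, hb]
  have h2 := norm_flow_single_ge (freq n) t.2
  have h3 : ‖flow (modeGen (freq n)) t (lp.single 2 (0 : ℤ) (1 : ℂ))‖ ≤ 1 := by
    refine (norm_flow_apply_le (modeGen_dissipative _) _ t.2).trans_eq ?_
    rw [lp.norm_single (by norm_num)]; simp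
  -- The lower bound is for the squared norm, which is at most the norm because the flow is a
  -- contraction.
  exact h2.trans (pow_le_of_le_one (norm_nonneg _) h3 two_ne_zero)

end Lorentz

end

theorem mainTheorem9 :
    -- the coercivity estimate and the hypocoercivity index
    Lorentz.CoerciveSum Lorentz.R Lorentz.J (Lorentz.secondOrder ∩ Lorentz.meanZero) 1
      ((3 - Real.sqrt 5) / 2) ∧
    Lorentz.IsHCIndex Lorentz.R Lorentz.J (Lorentz.secondOrder ∩ Lorentz.meanZero) 1 ∧
    -- the propagator `P t = exp (-C t)`
    ∃ P : NNReal → Lorentz.H →L[ℂ] Lorentz.H,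
      Lorentz.IsGeneratedBy P (-Lorentz.C) ∧
      (∀ Q, Lorentz.IsGeneratedBy Q (-Lorentz.C) → Q = P) ∧
      Lorentz.HypocoerciveOn P Lorentz.meanZero ∧
      -- the equilibrium and the long-time decay
      (∀ f₀ : Lorentz.H,
        (∀ g : Lorentz.H, ((g, 0) ∈ Lorentz.C.graph ∧ (∫ z, g z) = ∫ z, f₀ z) ↔
          g = Lorentz.equil f₀) ∧
        ∀ t : NNReal, ‖P t f₀ - Lorentz.equil f₀‖ ≤
          Real.sqrt 3 * Real.exp (-Lorentz.rate * t) * ‖f₀ - Lorentz.equil f₀‖) ∧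
      -- the short-time decay of the propagator norm
      ∃ c c' τ : ℝ, 0 < c ∧ 0 < c' ∧ 0 < τ ∧ ∀ t : NNReal, (t : ℝ) ≤ τ →
        1 - c' * (t : ℝ) ^ 3 ≤ ‖P t - Lorentz.projConst‖ ∧
        ‖P t - Lorentz.projConst‖ ≤ 1 - c * (t : ℝ) ^ 3 := by
  refine ⟨Lorentz.coerciveSum_one, Lorentz.isHCIndex_one, Lorentz.propagator,
    Lorentz.isGeneratedBy_propagator, fun Q hQ => Lorentz.generated_unique hQ,
    Lorentz.hypocoerciveOn_propagator,
    fun f₀ => ⟨Lorentz.equilibrium_iff f₀, Lorentz.norm_propagator_sub_equil_le f₀⟩, ?_⟩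
  set n : Fin 2 → ℤ := fun _ => 1
  have hn : n ≠ 0 := fun h => one_ne_zero (congr_fun h 0)
  -- Any nonzero frequency `n` would serve. The `+ 1` only makes the constant evidently positive.
  refine ⟨1 / 24000, ‖Lorentz.modeGen (Lorentz.freq n)‖ ^ 2 + 1, 1, by norm_num, by positivity,
    one_pos, fun t ht => ⟨?_, Lorentz.norm_propagator_sub_projConst_le ht⟩⟩
  refine le_trans ?_ (Lorentz.norm_propagator_sub_projConst_ge t n hn)
  have : (0 : ℝ) ≤ (t : ℝ) ^ 3 := by positivity
  linarith
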